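/- A *metric graph* consists of edges $e$, each identified with a bounded interval $[0,\ell_e]$, $0<\ell_e<\infty$, glued together at their endpoints, the vertices; multiple edges and self-loops are allowed. It is *compact* if it has finitely many vertices and edges. Let $\mathcal K$ be a compact metric graph, let $D,R$ be non-empty disjoint sets of vertices of $\mathcal K$, and let $\sigma:D\to R$ be a bijection. The *periodic graph* $\mathcal G$ with periodicity cell $\mathcal K$ and pasting rule $\sigma$ is the quotient of the disjoint union of copies $\mathcal K_i$ $(i\in\mathbb Z)$ of $\mathcal K$ in which, for all $i\in\mathbb Z$ and $v\in D$, the copy of $v$ in $\mathcal K_i$ is identified with the copy of $\sigma(v)$ in $\mathcal K_{i+1}$; it is assumed to be connected. A function $u:\mathcal G\to\mathbb R$ is a family $(u_e)_e$ of functions $u_e:[0,\ell_e]\to\mathbb R$ on the edges of $\mathcal G$. Let $H^1(\mathcal G)$ be the set of continuous $u:\mathcal G\to\mathbb R$ with $u_e\in H^1(0,\ell_e)$ for every edge $e$ and $\int_{\mathcal G}(|u|^2+|u'|^2)\,dx<\infty$, where $\int_{\mathcal G}$ denotes the sum over all edges $e$ of the integrals over $[0,\ell_e]$. For $\mu>0$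 and $p>2$ put $H^1_\mu(\mathcal G)=\{u\in H^1(\mathcal G):\int_{\mathcal G}|u|^2\,dx=\mu\}$ and $$E(u,\mathcal G)=\frac12\int_{\mathcal G}|u'|^2\,dx-\frac1p\int_{\mathcal G}|u|^p\,dx,\qquad \mathcal E_{\mathcal G}(\mu)=\inf_{u\in H^1_\mu(\mathcal G)}E(u,\mathcal G).$$ **Theorem 1.1.** Let $\mathcal G$ be a periodic graph and $p\in(2,6)$. Then, for every $\mu>0$, $$-\infty<\mathcal E_{\mathcal G}(\mu)<0,$$ and there exists a ground state with mass $\mu$, i.e. a function $u\in H^1_\mu(\mathcal G)$ such that $E(u,\mathcal G)=\mathcal E_{\mathcal G}(\mu)$. -/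

import Mathlib

open scoped ENNReal

/-- A metric graph with vertex set `V` and edge set `E`; multiple edges and self-loops are allowed.
The edge `e` is identified with the interval `[0, len e]`, whose point `0` is attached to the vertex
`src e` and whose point `len e` is attached to the vertex `tgt e`. All edges are bounded.
The graph is compact when `V` and `E` are finite. -/
structure MetricGraph (V E : Type*) where
  src : E → V
  tgt : E → V
  len : E → ℝ
  len_pos : ∀ e, 0 < len e

/-- A pasting rule on the vertices of a periodicity cell: disjoint non-empty sets `donors` and
`receivers` of vertices and a bijection `σ` from the first onto the second. -/
structure PastingRule (V : Type*) where
  donors : Set V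
  receivers : Set V
  donors_nonempty : donors.Nonempty
  receivers_nonempty : receivers.Nonempty
  disjoint : Disjoint donors receivers
  σ : donors ≃ receivers

namespace PastingRule

variable {V : Type*} (P : PastingRule V)

/-- The vertex `a = (i, v)` of the `i`-th copy of the cell is a donor, and the pasting rule glues it
to the receiver `b = (i + 1, σ v)` of the next copy. -/
def Glues (a b : ℤ × V) : Prop :=
  b.1 = a.1 + 1 ∧ ∃ h : a.2 ∈ P.donors, b.2 = P.σ ⟨a.2, h⟩

/-- The identification of vertices of the disjoint union of copies, indexed by `ℤ`, of the cell. -/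
def Rel (a b : ℤ × V) : Prop :=
  a = b ∨ P.Glues a b ∨ P.Glues b a

theorem Glues.mem_left {P : PastingRule V} {a b : ℤ × V} (h : P.Glues a b) : a.2 ∈ P.donors :=
  h.2.1

theorem Glues.mem_right {P : PastingRule V} {a b : ℤ × V} (h : P.Glues a b) :
    b.2 ∈ P.receivers := by
  obtain ⟨-, h1, h2⟩ := h
  rw [h2]
  exact (P.σ _).2

theorem Glues.absurd {P : PastingRule V} {a b c : ℤ × V} (h : P.Glues a b) (h' : P.Glues b c) :
    False :=
  Set.disjoint_left.mp P.disjoint h'.mem_left h.mem_right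

theorem Glues.right_unique {P : PastingRule V} {a b c : ℤ × V} (h : P.Glues a b)
    (h' : P.Glues a c) : b = c := by
  obtain ⟨h1, h2, h3⟩ := h
  obtain ⟨h1', h2', h3'⟩ := h'
  exact Prod.ext (h1.trans h1'.symm) (h3.trans h3'.symm)

theorem Glues.left_unique {P : PastingRule V} {a b c : ℤ × V} (h : P.Glues a c)
    (h' : P.Glues b c) : a = b := by
  obtain ⟨h1, h2, h3⟩ := h
  obtain ⟨h1', h2', h3'⟩ := h'
  refine Prod.ext (by omega) ?_
  have := P.σ.injective (Subtype.ext (h3.symm.trans h3'))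
  exact congrArg Subtype.val this

theorem rel_equivalence : Equivalence P.Rel where
  refl _ := Or.inl rfl
  symm := by
    rintro a b (h | h | h)
    · exact Or.inl h.symm
    · exact Or.inr (Or.inr h)
    · exact Or.inr (Or.inl h)
  trans := by
    rintro a b c (rfl | h | h) (rfl | h' | h')
    · exact Or.inl rfl
    · exact Or.inr (Or.inl h')
    · exact Or.inr (Or.inr h')
    · exact Or.inr (Or.inl h)
    · exact (h.absurd h').elim
    · exact Or.inl (h.left_unique h')
    · exact Or.inr (Or.inr h)
    · exact Or.inl (h.right_unique h')
    · exact (h'.absurd h).elim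

/-- The vertices of the periodic graph are the classes of this relation on `ℤ × V`. -/
def setoid : Setoid (ℤ × V) := ⟨P.Rel, P.rel_equivalence⟩

end PastingRule

namespace MetricGraph

variable {V E : Type*}

/-- The periodic graph with periodicity cell `K` and pasting rule `P`: infinitely many copies of
`K`, indexed by `ℤ`, glued together at their vertices as prescribed by `P`. -/
def periodic (K : MetricGraph V E) (P : PastingRule V) :
    MetricGraph (Quotient P.setoid) (ℤ × E) where
  src a := Quotient.mk P.setoid (a.1, K.src a.2)
  tgt a := Quotient.mk P.setoid (a.1, K.tgt a.2)
  len a := K.len a.2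
  len_pos a := K.len_pos a.2

variable (G : MetricGraph V E)

/-- Any two vertices are joined by a finite path of edges. -/
def Connected : Prop :=
  ∀ v w : V, Relation.EqvGen (fun a b => ∃ e, G.src e = a ∧ G.tgt e = b) v w

/-- `∫_G |f| ^ q dx`, with values in `[0, ∞]`, for a function on the graph given as a family of
functions on its edges. Here and below only the values `f e x` with `0 ≤ x ≤ len e` matter. -/
noncomputable def lpPow (q : ℝ) (f : E → ℝ → ℝ) : ℝ≥0∞ :=
  ∑' e, ∫⁻ x in Set.Ioo 0 (G.len e), ‖f e x‖ₑ ^ q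

/-- The Sobolev space `H¹(G)` of real-valued functions on the graph: on each edge the function is
absolutely continuous (so that its weak derivative is the almost everywhere defined classical one),
it is continuous at the vertices, that is, the edges that meet at a vertex `v` give the same value
`φ v` there, and the function and its derivative are square-integrable over the whole graph. -/
def H1 : Set (E → ℝ → ℝ) :=
  {u | (∀ e, AbsolutelyContinuousOnInterval (u e) 0 (G.len e)) ∧
    (∃ φ : V → ℝ, ∀ e, u e 0 = φ (G.src e) ∧ u e (G.len e) = φ (G.tgt e)) ∧
    G.lpPow 2 u < ∞ ∧ G.lpPow 2 (fun e => deriv (u e)) < ∞}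

/-- The functions in `H¹(G)` of mass `∫_G |u|² dx = μ`. -/
def H1Mass (μ : ℝ) : Set (E → ℝ → ℝ) :=
  {u | u ∈ G.H1 ∧ G.lpPow 2 u = ENNReal.ofReal μ}

/-- The NLS energy `E(u, G) = (1/2) ∫_G |u'|² dx - (1/p) ∫_G |u|ᵖ dx`. The first integral is finite
on `H¹(G)`; the energy would be `-∞` if the second were not. -/
noncomputable def energy (p : ℝ) (u : E → ℝ → ℝ) : EReal :=
  ((G.lpPow 2 (fun e => deriv (u e)) / 2 : ℝ≥0∞) : EReal) -
    ((G.lpPow p u / ENNReal.ofReal p : ℝ≥0∞) : EReal)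

/-- The ground state energy level: the infimum, in `[-∞, ∞]`, of the energy under the mass
constraint. -/
noncomputable def groundLevel (p μ : ℝ) : EReal :=
  ⨅ u ∈ G.H1Mass μ, G.energy p u

end MetricGraph

open Filter Topology MeasureTheory Set

/-! The proof is the direct method, with compactness restored by translation. Integrating `(u²)'`
along an edge and using Young's inequality bounds `u²` by mass and kinetic energy
(`AbsolutelyContinuousOnInterval.sq_le_integral`). Optimizing the Young parameter, `p < 6` lets the
kinetic term absorb the potential one (`H1.exists_le_realEnergy`), so the level is finite and
minimizing sequences are bounded in `H¹`. It is negative because a plateau over about `N` cells with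
slopes of order `1 / N` has a kinetic term that loses to the potential term, again since `p < 6`
(`exists_realEnergy_neg`).

Negativity prevents vanishing: a minimizing sequence keeps its `L^p` integral away from zero, so
some edge carries a fixed amount of mass (`H1.exists_edgeMass_gt`). Translating by whole periods
brings that edge into cell `0`, which has finitely many edges, so a weak limit `U` has positive mass
`m`.

Splitting of the mass does not pay either. By weak convergence and the Brezis–Lieb splitting, the
energies of `u n` separate in the limit into that of `U` and that of the remainders, whose masses
tend to `μ - m`. Rescaling to mass `μ` shows that a function of mass `m ≤ μ` has energy at least `(m
/ μ) I`, strictly more if `0 < m < μ`, because `p / 2 > 1` and `I < 0`. Applied to the remainders,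
this leaves `U` at most the energy `(m / μ) I`, which forces `m = μ` and makes `U` a minimizer
(`H1Mass.exists_realEnergy_le`). -/

/-! ### Weak compactness in Hilbert space and the Brezis–Lieb splitting. -/

theorem exists_subseq_tendsto_inner {H : Type*} [NormedAddCommGroup H] [InnerProductSpace ℝ H]
    [CompleteSpace H] [TopologicalSpace.SeparableSpace H] {x : ℕ → H} {C : ℝ}
    (hx : ∀ n, ‖x n‖ ≤ C) :
    ∃ (y : H) (φ : ℕ → ℕ), StrictMono φ ∧
      ∀ z, Tendsto (fun n => inner ℝ (x (φ n)) z) atTop (𝓝 (inner ℝ y z)) := by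
  obtain ⟨y, -, φ, hφ, h⟩ := WeakDual.isSeqCompact_closedBall (𝕜 := ℝ) (E := H) 0 C
    (x := fun n => StrongDual.toWeakDual (InnerProductSpace.toDual ℝ H (x n)))
    (fun n => by simpa using hx n)
  refine ⟨(InnerProductSpace.toDual ℝ H).symm (WeakDual.toStrongDual y), φ, hφ, fun z => ?_⟩
  simpa [Function.comp_def] using ((WeakDual.eval_continuous z).tendsto y).comp h

theorem abs_rpow_sub_rpow_le {x y R q : ℝ} (hx : 0 ≤ x) (hy : 0 ≤ y) (hxR : x ≤ R) (hyR : y ≤ R)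
    (hq : 1 ≤ q) : |x ^ q - y ^ q| ≤ q * R ^ (q - 1) * |x - y| := by
  have := (convex_Icc (0 : ℝ) R).norm_image_sub_le_of_norm_hasDerivWithin_le
    (f := fun t => t ^ q) (f' := fun t => q * t ^ (q - 1)) (C := q * R ^ (q - 1)) (x := y) (y := x)
    (fun t _ => (Real.hasDerivAt_rpow_const (Or.inr hq)).hasDerivWithinAt)
    (fun t ht => by
      rw [Real.norm_of_nonneg (mul_nonneg (by linarith) (Real.rpow_nonneg ht.1 _))]
      exact mul_le_mul_of_nonneg_left (Real.rpow_le_rpow ht.1 ht.2 (by linarith)) (by linarith))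
    ⟨hy, hyR⟩ ⟨hx, hxR⟩
  simpa [Real.norm_eq_abs] using this

/-- By symmetry `|b| ≤ |a|`. The mean value bound on `[0, 2 |a|]` then gives a factor `|b|` for the
first difference, and `|b| ^ q` is itself at most `R ^ (q - 2) |a| |b|`. The product `|a| |b|` is
the point: one factor can be the fixed limit function. -/
theorem abs_rpow_abs_add_sub_le {a b R q : ℝ} (ha : |a| ≤ R) (hb : |b| ≤ R) (hq : 2 ≤ q) :
    |(|a + b| ^ q - |a| ^ q - |b| ^ q)| ≤ (q * 2 ^ (q - 1) + 1) * R ^ (q - 2) * (|a| * |b|) := by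
  wlog hab : |b| ≤ |a| generalizing a b
  · have := this hb ha (le_of_not_ge hab)
    rw [add_comm b a, mul_comm |b|, sub_right_comm] at this
    exact this
  have hR : 0 ≤ R := (abs_nonneg a).trans ha
  have h1 : |(|a + b| ^ q - |a| ^ q)| ≤ q * (2 * |a|) ^ (q - 1) * |b| := by
    refine (abs_rpow_sub_rpow_le (abs_nonneg _) (abs_nonneg a) (R := 2 * |a|) ?_ ?_
      (by linarith)).trans ?_
    · linarith [abs_add_le a b]
    · linarith [abs_nonneg a]
    · refine mul_le_mul_of_nonneg_left ?_ (by positivity)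
      have := abs_abs_sub_abs_le_abs_sub (a + b) a
      simpa using this
  have h2 : ∀ {c : ℝ}, 0 ≤ c → c ^ (q - 1) = c ^ (q - 2) * c := fun {c} hc => by
    rw [← Real.rpow_add_one' hc (by linarith)]; congr 1; ring
  have h3 : |b| ^ q = |b| ^ (q - 2) * |b| * |b| := by
    rw [← h2 (abs_nonneg b), ← Real.rpow_add_one' (abs_nonneg b) (by linarith)]; congr 1; ring
  have h4 : |a| ^ (q - 2) ≤ R ^ (q - 2) := Real.rpow_le_rpow (abs_nonneg _) ha (by linarith)
  have h5 : |b| ^ (q - 2) ≤ R ^ (q - 2) := Real.rpow_le_rpow (abs_nonneg _) hb (by linarith)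
  have h6 : |b| ^ q ≤ R ^ (q - 2) * (|a| * |b|) := by
    rw [h3, mul_assoc]; gcongr
  have h7 : q * (2 * |a|) ^ (q - 1) * |b| ≤ q * 2 ^ (q - 1) * R ^ (q - 2) * (|a| * |b|) := by
    rw [Real.mul_rpow (by norm_num) (abs_nonneg a), h2 (abs_nonneg a)]
    calc q * (2 ^ (q - 1) * (|a| ^ (q - 2) * |a|)) * |b|
        = q * 2 ^ (q - 1) * |a| ^ (q - 2) * (|a| * |b|) := by ring
      _ ≤ _ := by gcongr
  calc _ ≤ |(|a + b| ^ q - |a| ^ q)| + |b| ^ q := by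
        refine (abs_sub _ _).trans ?_
        rw [abs_of_nonneg (Real.rpow_nonneg (abs_nonneg b) q)]
    _ ≤ _ := by rw [add_mul, add_mul, one_mul]; linarith

/-- A version of the Brezis–Lieb lemma for uniformly bounded sequences in `L²`. -/
theorem tendsto_integral_rpow_sub {X : Type*} [MeasurableSpace X] {ν : Measure X}
    {f : ℕ → X → ℝ} {g : X → ℝ} {M A q : ℝ} (hq : 2 ≤ q)
    (hf : ∀ n, MemLp (f n) 2 ν) (hg : MemLp g 2 ν)
    (hfM : ∀ n, ∀ᵐ x ∂ν, |f n x| ≤ M) (hgM : ∀ᵐ x ∂ν, |g x| ≤ M)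
    (hA : ∀ n, ∫ x, (f n x - g x) ^ 2 ∂ν ≤ A)
    (hlim : ∀ᵐ x ∂ν, Tendsto (fun n => f n x) atTop (𝓝 (g x))) :
    Tendsto (fun n => ∫ x, (|f n x| ^ q - |f n x - g x| ^ q - |g x| ^ q) ∂ν) atTop (𝓝 0) := by
  -- A negative `M` is possible when `ν = 0`.
  set M' := max M 0
  have hM' : 0 ≤ M' := le_max_right _ _
  set C := (q * 2 ^ (q - 1) + 1) * (2 * M') ^ (q - 2) with hC
  have hC0 : 0 ≤ C := by positivity
  set W : ℕ → X → ℝ := fun n x => |f n x| ^ q - |f n x - g x| ^ q - |g x| ^ q with hW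
  have hWb : ∀ n, ∀ᵐ x ∂ν, |W n x| ≤ C * (|f n x - g x| * |g x|) := by
    intro n
    filter_upwards [hfM n, hgM] with x h1 h2
    have h1' : |f n x| ≤ M' := h1.trans (le_max_left _ _)
    have h2' : |g x| ≤ M' := h2.trans (le_max_left _ _)
    have := abs_rpow_abs_add_sub_le (a := f n x - g x) (b := g x) (R := 2 * M')
      ((abs_sub _ _).trans (by linarith)) (h2'.trans (by linarith)) hq
    simpa [hW, hC] using this
  have hWm : ∀ n, AEStronglyMeasurable (W n) ν := by
    intro n
    have h1 := (hf n).1.aemeasurable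
    have h2 := hg.1.aemeasurable
    exact (by fun_prop : AEMeasurable (W n) ν).aestronglyMeasurable
  have hg2 : Integrable (fun x => g x ^ 2) ν := hg.integrable_sq
  have hd2 : ∀ n, Integrable (fun x => (f n x - g x) ^ 2) ν := fun n =>
    ((hf n).sub hg).integrable_sq
  have hWi : ∀ n, Integrable (W n) ν := by
    intro n
    refine Integrable.mono' (((hd2 n).add hg2).const_mul C) (hWm n) ?_
    filter_upwards [hWb n] with x hx
    refine hx.trans (mul_le_mul_of_nonneg_left ?_ hC0)
    simp only [Pi.add_apply]
    nlinarith [sq_nonneg (|f n x - g x| - |g x|), sq_abs (f n x - g x), sq_abs (g x),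
      sq_nonneg (f n x - g x), sq_nonneg (g x)]
  have hWlim : ∀ᵐ x ∂ν, Tendsto (fun n => |W n x|) atTop (𝓝 0) := by
    filter_upwards [hlim] with x hx
    have h1 : Tendsto (fun n => W n x) atTop (𝓝 (|g x| ^ q - |g x - g x| ^ q - |g x| ^ q)) := by
      refine Tendsto.sub (Tendsto.sub ?_ ?_) tendsto_const_nhds
      · exact (hx.abs).rpow_const (Or.inr (by linarith))
      · exact ((hx.sub_const _).abs).rpow_const (Or.inr (by linarith))
    have h2 : |g x| ^ q - |g x - g x| ^ q - |g x| ^ q = 0 := by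
      rw [sub_self, abs_zero, Real.zero_rpow (by linarith)]; ring
    rw [h2] at h1
    simpa using h1.abs
  have hA0 : 0 ≤ A := (integral_nonneg fun x => sq_nonneg _).trans (hA 0)
  -- The bound `C |f n - g| |g|` varies with `n`. Young's inequality trades it for `δ (f n - g)²`
  -- plus a multiple of `g²`; after subtracting the former, the fixed function `g²` dominates.
  have key : ∀ δ : ℝ, 0 < δ → Tendsto (fun n => ∫ x, max (|W n x| - δ * (f n x - g x) ^ 2) 0 ∂ν)
      atTop (𝓝 0) := by
    intro δ hδ
    have := tendsto_integral_of_dominated_convergence (μ := ν) (f := fun _ => (0 : ℝ))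
      (F := fun n x => max (|W n x| - δ * (f n x - g x) ^ 2) 0)
      (fun x => C ^ 2 / (4 * δ) * g x ^ 2) (fun n => ?_) (hg2.const_mul _) (fun n => ?_) ?_
    · simpa using this
    · have h1 := (hf n).1.aemeasurable
      have h2 := hg.1.aemeasurable
      have h3 := (hWm n).aemeasurable
      exact (by fun_prop : AEMeasurable _ ν).aestronglyMeasurable
    · filter_upwards [hWb n] with x hx
      rw [Real.norm_of_nonneg (le_max_right _ _)]
      refine max_le ?_ (by positivity)
      have : C * (|f n x - g x| * |g x|) - δ * (f n x - g x) ^ 2 ≤ C ^ 2 / (4 * δ) * g x ^ 2 := by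
        rw [← sq_abs (f n x - g x), ← sq_abs (g x)]
        have h : C ^ 2 / (4 * δ) * |g x| ^ 2 - C * (|f n x - g x| * |g x|)
            + δ * |f n x - g x| ^ 2 = δ * (|f n x - g x| - C / (2 * δ) * |g x|) ^ 2 := by
          field_simp; ring
        have h' : 0 ≤ δ * (|f n x - g x| - C / (2 * δ) * |g x|) ^ 2 := by positivity
        linarith
      linarith
    · filter_upwards [hWlim, hlim] with x hx hx'
      have h1 : Tendsto (fun n => max (|W n x| - δ * (f n x - g x) ^ 2) 0) atTop
          (𝓝 (max (0 - δ * (g x - g x) ^ 2) 0)) :=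
        ((hx.sub (((hx'.sub_const _).pow 2).const_mul δ)).max tendsto_const_nhds)
      simpa using h1
  rw [Metric.tendsto_atTop]
  intro ε hε
  -- With this `δ` the subtracted part integrates to at most `δ A ≤ ε / 2`; `A + 1` replaces `A`,
  -- which may be zero.
  obtain ⟨N, hN⟩ := (Metric.tendsto_atTop.1 (key (ε / (2 * (A + 1))) (by positivity))) (ε / 2)
    (by positivity)
  refine ⟨N, fun n hn => ?_⟩
  have h1 := hN n hn
  rw [Real.dist_0_eq_abs] at h1 ⊢
  set δ := ε / (2 * (A + 1)) with hδ
  have hδ0 : 0 < δ := by positivity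
  have hi : Integrable (fun x => max (|W n x| - δ * (f n x - g x) ^ 2) 0) ν := by
    have := (((hWi n).abs).sub ((hd2 n).const_mul δ)).pos_part
    exact this
  calc |∫ x, W n x ∂ν| ≤ ∫ x, |W n x| ∂ν := abs_integral_le_integral_abs
    _ ≤ ∫ x, (max (|W n x| - δ * (f n x - g x) ^ 2) 0 + δ * (f n x - g x) ^ 2) ∂ν := by
        refine integral_mono (hWi n).abs (hi.add ((hd2 n).const_mul δ)) fun x => ?_
        have := le_max_left (|W n x| - δ * (f n x - g x) ^ 2) 0
        simp only
        linarith
    _ = ∫ x, max (|W n x| - δ * (f n x - g x) ^ 2) 0 ∂ν + δ * ∫ x, (f n x - g x) ^ 2 ∂ν := by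
        rw [integral_add hi ((hd2 n).const_mul δ), integral_const_mul]
    _ < ε := by
        have h2 := (le_abs_self _).trans_lt h1
        have h3 : δ * ∫ x, (f n x - g x) ^ 2 ∂ν ≤ δ * A := mul_le_mul_of_nonneg_left (hA n) hδ0.le
        have h4 : δ * A ≤ ε / 2 := by
          rw [hδ, div_mul_eq_mul_div, div_le_div_iff₀ (by positivity) (by positivity)]
          nlinarith
        linarith

/-- A power of exponent less than two is absorbed by a small multiple of the square. -/
theorem exists_rpow_le_sq_add {s : ℝ} (hs0 : 0 ≤ s) (hs : s < 2) {ε : ℝ} (hε : 0 < ε) :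
    ∃ C, 0 ≤ C ∧ ∀ z : ℝ, 0 ≤ z → z ^ s ≤ ε * z ^ 2 + C := by
  have h1 : Tendsto (fun z : ℝ => z ^ (s - 2)) atTop (𝓝 0) := by
    have := tendsto_rpow_neg_atTop (y := 2 - s) (by linarith)
    simpa using this
  obtain ⟨R, hR⟩ := eventually_atTop.1 (h1.eventually (ge_mem_nhds hε))
  refine ⟨(max R 1) ^ s, by positivity, fun z hz => ?_⟩
  rcases le_total z (max R 1) with h | h
  · have := Real.rpow_le_rpow hz h hs0
    nlinarith [sq_nonneg z]
  · have h0 : 0 < z := lt_of_lt_of_le (by positivity) h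
    have h2 := hR z ((le_max_left _ _).trans h)
    have h3 : z ^ s = z ^ (s - 2) * z ^ 2 := by
      rw [← Real.rpow_natCast z 2, ← Real.rpow_add h0]; congr 1; norm_num
    have h4 : (0 : ℝ) ≤ (max R 1) ^ s := by positivity
    rw [h3]
    nlinarith [sq_nonneg z]

/-! ### Integrals over the graph as integrals for one measure; linear structure of `H¹`. -/

namespace MetricGraph

variable {V E : Type*} (G : MetricGraph V E)

section Measure

variable [MeasurableSpace E]

/-- The length measure on the disjoint union of the edges. -/
noncomputable def edgeMeasure : Measure (E × ℝ) :=
  Measure.sum fun e => (volume.restrict (Ioo 0 (G.len e))).map (Prod.mk e)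

theorem lpPow_eq_lintegral [MeasurableSingletonClass E] (q : ℝ) (f : E → ℝ → ℝ) :
    G.lpPow q f = ∫⁻ z, ‖f z.1 z.2‖ₑ ^ q ∂G.edgeMeasure := by
  rw [edgeMeasure, lintegral_sum_measure]
  exact tsum_congr fun e => ((measurableEmbedding_prodMk_left e).lintegral_map
    fun z => ‖f z.1 z.2‖ₑ ^ q).symm

theorem ae_edgeMeasure_iff [MeasurableSingletonClass E] [Countable E] {p : E × ℝ → Prop} :
    (∀ᵐ z ∂G.edgeMeasure, p z) ↔ ∀ e, ∀ᵐ x ∂volume.restrict (Ioo 0 (G.len e)), p (e, x) := by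
  rw [edgeMeasure, Measure.ae_sum_iff]
  exact forall_congr' fun e => (measurableEmbedding_prodMk_left e).ae_map_iff

theorem aestronglyMeasurable_edgeMeasure_iff [MeasurableSingletonClass E] [Countable E]
    {f : E × ℝ → ℝ} :
    AEStronglyMeasurable f G.edgeMeasure ↔
      ∀ e, AEStronglyMeasurable (fun x => f (e, x)) (volume.restrict (Ioo 0 (G.len e))) := by
  rw [edgeMeasure, aestronglyMeasurable_sum_measure_iff]
  exact forall_congr' fun e => (measurableEmbedding_prodMk_left e).aestronglyMeasurable_map_iff

instance [Countable E] : SFinite G.edgeMeasure := by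
  unfold edgeMeasure; infer_instance

theorem memLp_two_of_lpPow_lt_top [MeasurableSingletonClass E] [Countable E] {f : E → ℝ → ℝ}
    (hf : ∀ e, AEStronglyMeasurable (f e) (volume.restrict (Ioo 0 (G.len e))))
    (h : G.lpPow 2 f < ∞) : MemLp (fun z : E × ℝ => f z.1 z.2) 2 G.edgeMeasure := by
  refine ⟨G.aestronglyMeasurable_edgeMeasure_iff.2 hf, ?_⟩
  rw [eLpNorm_lt_top_iff_lintegral_rpow_enorm_lt_top (by norm_num) (by norm_num)]
  rw [lpPow_eq_lintegral] at h
  simpa using h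

theorem lpPow_two_lt_top_of_memLp [MeasurableSingletonClass E] {f : E → ℝ → ℝ}
    (h : MemLp (fun z : E × ℝ => f z.1 z.2) 2 G.edgeMeasure) : G.lpPow 2 f < ∞ := by
  have := h.2
  rw [eLpNorm_lt_top_iff_lintegral_rpow_enorm_lt_top (by norm_num) (by norm_num)] at this
  rw [lpPow_eq_lintegral]
  simpa using this

theorem toReal_lpPow [MeasurableSingletonClass E] [Countable E] {f : E → ℝ → ℝ} {q : ℝ}
    (hq : 0 ≤ q)
    (hf : ∀ e, AEStronglyMeasurable (f e) (volume.restrict (Ioo 0 (G.len e)))) :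
    (G.lpPow q f).toReal = ∫ z, |f z.1 z.2| ^ q ∂G.edgeMeasure := by
  have hm := G.aestronglyMeasurable_edgeMeasure_iff (f := fun z => f z.1 z.2) |>.2 hf
  rw [lpPow_eq_lintegral, integral_eq_lintegral_of_nonneg_ae]
  · congr 1
    refine lintegral_congr fun z => ?_
    rw [← Real.norm_eq_abs, ← ENNReal.ofReal_rpow_of_nonneg (norm_nonneg _) hq, ofReal_norm]
  · exact Eventually.of_forall fun z => by positivity
  · have := hm.aemeasurable
    exact (by fun_prop : AEMeasurable _ _).aestronglyMeasurable

theorem toReal_lpPow_two [MeasurableSingletonClass E] [Countable E] {f : E → ℝ → ℝ}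
    (hf : ∀ e, AEStronglyMeasurable (f e) (volume.restrict (Ioo 0 (G.len e)))) :
    (G.lpPow 2 f).toReal = ∫ z, f z.1 z.2 ^ 2 ∂G.edgeMeasure := by
  rw [G.toReal_lpPow (by norm_num) hf]
  simp

end Measure

theorem lpPow_congr {q : ℝ} {f g : E → ℝ → ℝ}
    (h : ∀ e, f e =ᵐ[volume.restrict (Ioo 0 (G.len e))] g e) : G.lpPow q f = G.lpPow q g :=
  tsum_congr fun e => lintegral_congr_ae <| (h e).mono fun x hx => by simp only [hx]

theorem lpPow_const_mul {q : ℝ} (hq : 0 ≤ q) (c : ℝ) (f : E → ℝ → ℝ) :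
    G.lpPow q (fun e x => c * f e x) = ENNReal.ofReal (|c| ^ q) * G.lpPow q f := by
  have hc : ‖c‖ₑ ^ q = ENNReal.ofReal (|c| ^ q) := by
    rw [← Real.norm_eq_abs, ← ENNReal.ofReal_rpow_of_nonneg (norm_nonneg _) hq, ofReal_norm]
  simp only [lpPow, enorm_mul, ENNReal.mul_rpow_of_nonneg _ _ hq]
  rw [← ENNReal.tsum_mul_left]
  refine tsum_congr fun e => ?_
  rw [lintegral_const_mul' _ _ (by rw [hc]; exact ENNReal.ofReal_ne_top), hc]

/-- A bounded function has its `q`-th power integral controlled by its mass. -/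
theorem lpPow_le_of_bound {q M : ℝ} (hq : 2 ≤ q) {f : E → ℝ → ℝ}
    (hM : ∀ e, ∀ x ∈ Ioo 0 (G.len e), |f e x| ≤ M) :
    G.lpPow q f ≤ ENNReal.ofReal (M ^ (q - 2)) * G.lpPow 2 f := by
  simp only [lpPow]
  rw [← ENNReal.tsum_mul_left]
  refine ENNReal.tsum_le_tsum fun e => ?_
  rw [← lintegral_const_mul' _ _ ENNReal.ofReal_ne_top]
  refine setLIntegral_mono' measurableSet_Ioo fun x hx => ?_
  have h := hM e x hx
  have h0 : (0 : ℝ) ≤ M := (abs_nonneg _).trans h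
  rw [show q = (q - 2) + 2 by ring, ENNReal.rpow_add_of_nonneg _ _ (by linarith) (by norm_num)]
  gcongr
  rw [show q - 2 + 2 - 2 = q - 2 by ring,
    ← ENNReal.ofReal_rpow_of_nonneg h0 (by linarith), ← ofReal_norm]
  gcongr
  simpa using h

variable {G}

theorem H1.aestronglyMeasurable {u : E → ℝ → ℝ} (hu : u ∈ G.H1) (e : E) :
    AEStronglyMeasurable (u e) (volume.restrict (Ioo 0 (G.len e))) := by
  have := (hu.1 e).continuousOn
  rw [uIcc_of_le (G.len_pos e).le] at this
  exact (this.mono Ioo_subset_Icc_self).aestronglyMeasurable measurableSet_Ioo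

theorem H1.aestronglyMeasurable_deriv (u : E → ℝ → ℝ) (e : E) :
    AEStronglyMeasurable (deriv (u e)) (volume.restrict (Ioo 0 (G.len e))) :=
  (measurable_deriv _).aestronglyMeasurable

theorem H1.ae_differentiableAt {u : E → ℝ → ℝ} (hu : u ∈ G.H1) (e : E) :
    ∀ᵐ x ∂volume.restrict (Ioo 0 (G.len e)), DifferentiableAt ℝ (u e) x := by
  rw [ae_restrict_iff' measurableSet_Ioo]
  filter_upwards [(hu.1 e).ae_differentiableAt] with x hx hx'
  rw [uIcc_of_le (G.len_pos e).le] at hx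
  exact hx (Ioo_subset_Icc_self hx')

theorem H1.lpPow_deriv_const_mul (c : ℝ) (u : E → ℝ → ℝ) :
    G.lpPow 2 (fun e => deriv fun x => c * u e x) =
      ENNReal.ofReal (c ^ 2) * G.lpPow 2 (fun e => deriv (u e)) := by
  have : (fun e => deriv fun x => c * u e x) = fun e x => c * deriv (u e) x := by
    funext e x; exact deriv_const_mul_field c
  rw [this, G.lpPow_const_mul (by norm_num)]
  simp

theorem H1.const_mul {u : E → ℝ → ℝ} (hu : u ∈ G.H1) (c : ℝ) : (fun e x => c * u e x) ∈ G.H1 := by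
  obtain ⟨h1, ⟨φ, h2⟩, h3, h4⟩ := hu
  refine ⟨fun e => (h1 e).const_mul c, ⟨fun v => c * φ v, fun e => by simp [h2 e]⟩, ?_, ?_⟩
  · rw [G.lpPow_const_mul (by norm_num)]
    exact ENNReal.mul_lt_top ENNReal.ofReal_lt_top h3
  · rw [H1.lpPow_deriv_const_mul]
    exact ENNReal.mul_lt_top ENNReal.ofReal_lt_top h4

theorem H1.deriv_sub_ae {u v : E → ℝ → ℝ} (hu : u ∈ G.H1) (hv : v ∈ G.H1) (e : E) :
    (deriv fun x => u e x - v e x) =ᵐ[volume.restrict (Ioo 0 (G.len e))]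
      fun x => deriv (u e) x - deriv (v e) x := by
  filter_upwards [H1.ae_differentiableAt hu e, H1.ae_differentiableAt hv e] with x h1 h2
  exact deriv_fun_sub h1 h2

theorem H1.memLp [MeasurableSpace E] [MeasurableSingletonClass E] [Countable E] {u : E → ℝ → ℝ}
    (hu : u ∈ G.H1) : MemLp (fun z : E × ℝ => u z.1 z.2) 2 G.edgeMeasure :=
  G.memLp_two_of_lpPow_lt_top (H1.aestronglyMeasurable hu) hu.2.2.1

theorem H1.memLp_deriv [MeasurableSpace E] [MeasurableSingletonClass E] [Countable E]
    {u : E → ℝ → ℝ} (hu : u ∈ G.H1) :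
    MemLp (fun z : E × ℝ => deriv (u z.1) z.2) 2 G.edgeMeasure :=
  G.memLp_two_of_lpPow_lt_top (f := fun e => deriv (u e)) (H1.aestronglyMeasurable_deriv u)
    hu.2.2.2

theorem H1.sub [Countable E] {u v : E → ℝ → ℝ} (hu : u ∈ G.H1) (hv : v ∈ G.H1) :
    (fun e x => u e x - v e x) ∈ G.H1 := by
  -- The edge set is countable, so the discrete σ-algebra makes the edgewise integrals into one
  -- integral over `E × ℝ`.
  let _ : MeasurableSpace E := ⊤
  have : DiscreteMeasurableSpace E := ⟨fun _ => trivial⟩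
  refine ⟨fun e => (hu.1 e).sub (hv.1 e), ?_, ?_, ?_⟩
  · obtain ⟨φ, h2⟩ := hu.2.1
    obtain ⟨ψ, h2'⟩ := hv.2.1
    exact ⟨fun w => φ w - ψ w, fun e => by simp [h2 e, h2' e]⟩
  · exact G.lpPow_two_lt_top_of_memLp (f := fun e x => u e x - v e x)
      ((H1.memLp hu).sub (H1.memLp hv))
  · rw [G.lpPow_congr (H1.deriv_sub_ae hu hv)]
    exact G.lpPow_two_lt_top_of_memLp (f := fun e x => deriv (u e) x - deriv (v e) x)
      ((H1.memLp_deriv hu).sub (H1.memLp_deriv hv))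

end MetricGraph

/-! ### Pointwise bound on an edge, and inner products in `L²`. -/

/-- A pointwise bound of an absolutely continuous function on an interval by its `H¹` norm. -/
theorem AbsolutelyContinuousOnInterval.sq_le_integral {f : ℝ → ℝ} {ℓ : ℝ} (hℓ : 0 < ℓ)
    (hf : AbsolutelyContinuousOnInterval f 0 ℓ)
    (hd : IntegrableOn (fun x => deriv f x ^ 2) (Ioo 0 ℓ)) {t : ℝ} (ht : 0 < t) {x : ℝ}
    (hx : x ∈ Icc 0 ℓ) :
    f x ^ 2 ≤ (1 / ℓ + t) * (∫ y in Ioo 0 ℓ, f y ^ 2) + 1 / t * ∫ y in Ioo 0 ℓ, deriv f y ^ 2 := by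
  have hfc : ContinuousOn f (Icc 0 ℓ) := by simpa [uIcc_of_le hℓ.le] using hf.continuousOn
  have hf2 : IntegrableOn (fun x => f x ^ 2) (Ioo 0 ℓ) :=
    ((hfc.pow 2).integrableOn_Icc).mono_set Ioo_subset_Icc_self
  set h : ℝ → ℝ := fun y => t * f y ^ 2 + 1 / t * deriv f y ^ 2 with hh
  have hhi : IntegrableOn h (Ioo 0 ℓ) := (hf2.const_mul t).add (hd.const_mul (1 / t))
  set J := ∫ y in Ioo 0 ℓ, h y with hJ
  have hJe : J = t * (∫ y in Ioo 0 ℓ, f y ^ 2) + 1 / t * ∫ y in Ioo 0 ℓ, deriv f y ^ 2 := by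
    rw [hJ, hh, integral_add (hf2.const_mul t) (hd.const_mul (1 / t)), integral_const_mul,
      integral_const_mul]
  -- The difference of squares is the integral of `2 f f'`, and `|2 f f'| ≤ t f² + f'² / t = h`.
  have key : ∀ y ∈ Icc 0 ℓ, f x ^ 2 ≤ f y ^ 2 + J := by
    intro y hy
    have hsub : uIcc y x ⊆ uIcc 0 ℓ := by
      rw [uIcc_of_le hℓ.le]; exact uIcc_subset_Icc hy hx
    have hac := hf.mono hsub
    have h1 := hac.integral_deriv_mul_eq_sub hac
    have h2 : ‖∫ s in y..x, (deriv f s * f s + f s * deriv f s)‖ ≤ J := by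
      refine (intervalIntegral.norm_integral_le_integral_norm_uIoc).trans ?_
      have hsub' : uIoc y x ⊆ Ioc 0 ℓ := by
        rw [← uIoc_of_le hℓ.le]; exact uIoc_subset_uIoc_of_uIcc_subset_uIcc hsub
      have hhi' : IntegrableOn h (Ioc 0 ℓ) :=
        (integrableOn_Ioc_iff_integrableOn_Ioo (by finiteness)).2 hhi
      calc _ ≤ ∫ s in uIoc y x, h s := by
            refine integral_mono_of_nonneg (Eventually.of_forall fun _ => norm_nonneg _)
              (hhi'.mono_set hsub') (Eventually.of_forall fun s => ?_)
            simp only [hh, Real.norm_eq_abs]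
            have e : t * f s ^ 2 + 1 / t * deriv f s ^ 2 =
                t * (f s - deriv f s / t) ^ 2 + 2 * (f s * deriv f s) := by
              field_simp; ring
            have e' : t * f s ^ 2 + 1 / t * deriv f s ^ 2 =
                t * (f s + deriv f s / t) ^ 2 - 2 * (f s * deriv f s) := by
              field_simp; ring
            have p1 : 0 ≤ t * (f s - deriv f s / t) ^ 2 := by positivity
            have p2 : 0 ≤ t * (f s + deriv f s / t) ^ 2 := by positivity
            rw [abs_le]
            constructor <;> nlinarith
        _ ≤ ∫ s in Ioc 0 ℓ, h s :=
            setIntegral_mono_set hhi' (Eventually.of_forall fun s => by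
              simp only [hh, Pi.zero_apply]; positivity) hsub'.eventuallyLE
        _ = J := integral_Ioc_eq_integral_Ioo
    rw [h1, Real.norm_eq_abs] at h2
    have := (abs_le.1 h2).2
    nlinarith
  -- Averaging `key` over `y` produces the term with `1 / ℓ`.
  have h3 : ∫ _ in Ioo 0 ℓ, f x ^ 2 ≤ ∫ y in Ioo 0 ℓ, (f y ^ 2 + J) := by
    refine setIntegral_mono_on (by simp) (hf2.add (by simp)) measurableSet_Ioo
      fun y hy => key y (Ioo_subset_Icc_self hy)
  rw [integral_add hf2 (by simp)] at h3
  simp only [integral_const, MeasurableSet.univ, measureReal_restrict_apply, univ_inter,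
    Real.volume_real_Ioo_of_le hℓ.le, smul_eq_mul, sub_zero] at h3
  have h4 : f x ^ 2 ≤ 1 / ℓ * (∫ y in Ioo 0 ℓ, f y ^ 2) + J := by
    rw [one_div, ← div_eq_inv_mul, ← sub_le_iff_le_add, le_div_iff₀ hℓ]
    linarith
  rw [hJe] at h4
  linarith

theorem inner_toLp_two {X : Type*} [MeasurableSpace X] {ν : Measure X} {f g : X → ℝ}
    (hf : MemLp f 2 ν) (hg : MemLp g 2 ν) :
    inner ℝ (hf.toLp f) (hg.toLp g) = ∫ x, f x * g x ∂ν := by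
  rw [L2.inner_def]
  refine integral_congr_ae ?_
  filter_upwards [hf.coeFn_toLp, hg.coeFn_toLp] with x h1 h2
  simp [h1, h2, mul_comm]

theorem integral_sub_sq_le {X : Type*} [MeasurableSpace X] {ν : Measure X} {f g : X → ℝ}
    (hf : MemLp f 2 ν) (hg : MemLp g 2 ν) :
    ∫ x, (f x - g x) ^ 2 ∂ν ≤ 2 * (∫ x, f x ^ 2 ∂ν) + 2 * ∫ x, g x ^ 2 ∂ν := by
  have i1 := hf.integrable_sq
  have i2 := hg.integrable_sq
  rw [← integral_const_mul, ← integral_const_mul, ← integral_add (i1.const_mul 2) (i2.const_mul 2)]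
  refine integral_mono (hf.sub hg).integrable_sq ((i1.const_mul 2).add (i2.const_mul 2)) fun x => ?_
  beta_reduce
  nlinarith [sq_nonneg (f x + g x)]

/-! ### Weak limits in `H¹(G)` and splitting of the integrals. -/

namespace MetricGraph

variable {V E : Type*} (G : MetricGraph V E)

section Measure

variable [MeasurableSpace E] [MeasurableSingletonClass E]

theorem restrict_edgeMeasure (e : E) {b : ℝ} (hb : b ≤ G.len e) :
    G.edgeMeasure.restrict ({e} ×ˢ Ioo 0 b) = (volume.restrict (Ioo 0 b)).map (Prod.mk e) := by
  have hs : MeasurableSet (({e} : Set E) ×ˢ Ioo 0 b) :=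
    (measurableSet_singleton e).prod measurableSet_Ioo
  rw [edgeMeasure, Measure.restrict_sum _ hs]
  ext S hS
  rw [Measure.sum_apply _ hS, tsum_eq_single e]
  · rw [(measurableEmbedding_prodMk_left e).restrict_map,
      Measure.restrict_restrict ((measurableEmbedding_prodMk_left e).measurable hs)]
    congr 3
    ext x
    simp only [mem_inter_iff, mem_preimage, mem_prod, mem_singleton_iff, true_and, mem_Ioo]
    exact ⟨fun h => h.1, fun h => ⟨h, h.1, h.2.trans_le hb⟩⟩
  · intro e' he
    rw [(measurableEmbedding_prodMk_left e').restrict_map]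
    have : Prod.mk e' ⁻¹' (({e} : Set E) ×ˢ Ioo 0 b) = ∅ := by
      ext x; simp [he]
    simp [this]

theorem memLp_edge {f : E × ℝ → ℝ} (hf : MemLp f 2 G.edgeMeasure) (e : E) :
    MemLp (fun x => f (e, x)) 2 (volume.restrict (Ioo 0 (G.len e))) := by
  have h : MemLp f 2 ((volume.restrict (Ioo 0 (G.len e))).map (Prod.mk e)) :=
    hf.mono_measure (Measure.le_sum _ e)
  exact ((measurableEmbedding_prodMk_left e).memLp_map_measure_iff).1 h

theorem toReal_lpPow_two_eq_norm_sq [Countable E] {f : E → ℝ → ℝ}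
    (hf : ∀ e, AEStronglyMeasurable (f e) (volume.restrict (Ioo 0 (G.len e))))
    (h : MemLp (fun z : E × ℝ => f z.1 z.2) 2 G.edgeMeasure) :
    (G.lpPow 2 f).toReal = ‖h.toLp _‖ ^ 2 := by
  rw [G.toReal_lpPow_two hf, ← real_inner_self_eq_norm_sq, inner_toLp_two]
  simp only [sq]

/-- The integral over the initial part of an edge is a weakly continuous functional. -/
theorem tendsto_integral_edge [Countable E] {F : ℕ → E × ℝ → ℝ}
    (hF : ∀ n, MemLp (F n) 2 G.edgeMeasure)
    {y : Lp ℝ 2 G.edgeMeasure}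
    (h : ∀ z, Tendsto (fun n => inner ℝ ((hF n).toLp (F n)) z) atTop (𝓝 (inner ℝ y z)))
    (e : E) {b : ℝ} (hb0 : 0 ≤ b) (hb : b ≤ G.len e) :
    Tendsto (fun n => ∫ s in (0 : ℝ)..b, F n (e, s)) atTop (𝓝 (∫ s in (0 : ℝ)..b, y (e, s))) := by
  have hs : MeasurableSet (({e} : Set E) ×ˢ Ioo 0 b) :=
    (measurableSet_singleton e).prod measurableSet_Ioo
  have hν : G.edgeMeasure (({e} : Set E) ×ˢ Ioo 0 b) ≠ ∞ := by
    rw [← Measure.restrict_apply_univ, G.restrict_edgeMeasure e hb,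
      Measure.map_apply measurable_prodMk_left MeasurableSet.univ]
    simp
  have hint : ∀ w : E × ℝ → ℝ, ∫ z in (({e} : Set E) ×ˢ Ioo 0 b), w z ∂G.edgeMeasure =
      ∫ s in (0 : ℝ)..b, w (e, s) := by
    intro w
    rw [G.restrict_edgeMeasure e hb, (measurableEmbedding_prodMk_left e).integral_map,
      intervalIntegral.integral_of_le hb0, integral_Ioc_eq_integral_Ioo]
  -- The functional is the inner product with the indicator of `{e} × (0, b)`, a set of finite
  -- measure.
  have := h (indicatorConstLp 2 hs hν 1)
  simp only [fun w : Lp ℝ 2 G.edgeMeasure => real_inner_comm (indicatorConstLp 2 hs hν (1 : ℝ)) w,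
    L2.inner_indicatorConstLp_one, hint] at this
  refine this.congr fun n => ?_
  rw [← hint, ← hint]
  exact integral_congr_ae (ae_restrict_of_ae (hF n).coeFn_toLp)

end Measure

variable {G}

theorem H1.apply_eq_add_integral {u : E → ℝ → ℝ} (hu : u ∈ G.H1) (e : E) {x : ℝ}
    (hx : x ∈ Icc 0 (G.len e)) : u e x = u e 0 + ∫ s in (0 : ℝ)..x, deriv (u e) s := by
  have hsub : uIcc 0 x ⊆ uIcc 0 (G.len e) := by
    rw [uIcc_of_le (G.len_pos e).le, uIcc_of_le hx.1]; exact Icc_subset_Icc_right hx.2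
  rw [((hu.1 e).mono hsub).integral_deriv_eq_sub]; ring

theorem H1.toReal_lpPow_deriv [MeasurableSpace E] [MeasurableSingletonClass E] [Countable E]
    {u : E → ℝ → ℝ} (hu : u ∈ G.H1) :
    (G.lpPow 2 fun e => deriv (u e)).toReal = ‖(H1.memLp_deriv hu).toLp _‖ ^ 2 :=
  G.toReal_lpPow_two_eq_norm_sq (f := fun e => deriv (u e)) (H1.aestronglyMeasurable_deriv u) _

theorem H1.toReal_lpPow_deriv_sub [MeasurableSpace E] [MeasurableSingletonClass E] [Countable E]
    {u v : E → ℝ → ℝ} (hu : u ∈ G.H1) (hv : v ∈ G.H1) :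
    (G.lpPow 2 fun e => deriv fun x => u e x - v e x).toReal =
      ‖(H1.memLp_deriv hu).toLp _ - (H1.memLp_deriv hv).toLp _‖ ^ 2 := by
  rw [G.lpPow_congr (H1.deriv_sub_ae hu hv), ← MemLp.toLp_sub]
  exact G.toReal_lpPow_two_eq_norm_sq (f := fun e x => deriv (u e) x - deriv (v e) x)
    (fun e => (H1.aestronglyMeasurable_deriv u e).sub (H1.aestronglyMeasurable_deriv v e)) _

/-- Weak sequential compactness of bounded sets in `H¹(G)`. -/
theorem H1.exists_subseq_tendsto [Countable E] {u : ℕ → E → ℝ → ℝ} (hu : ∀ n, u n ∈ G.H1)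
    {M A K : ℝ} (hM : ∀ n e, ∀ x ∈ Icc 0 (G.len e), |u n e x| ≤ M)
    (hA : ∀ n, G.lpPow 2 (u n) ≤ ENNReal.ofReal A)
    (hK : ∀ n, (G.lpPow 2 fun e => deriv (u n e)).toReal ≤ K) :
    ∃ U ∈ G.H1, ∃ φ : ℕ → ℕ, StrictMono φ ∧
      (∀ e, ∀ x ∈ Icc 0 (G.len e), Tendsto (fun n => u (φ n) e x) atTop (𝓝 (U e x))) ∧
      Tendsto (fun n => (G.lpPow 2 fun e => deriv (u (φ n) e)).toReal -
        (G.lpPow 2 fun e => deriv fun x => u (φ n) e x - U e x).toReal) atTop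
        (𝓝 (G.lpPow 2 fun e => deriv (U e)).toReal) := by
  let _ : MeasurableSpace E := ⊤
  have : DiscreteMeasurableSpace E := ⟨fun _ => trivial⟩
  have : Fact ((2 : ℝ≥0∞) ≠ ∞) := ⟨by simp⟩
  have hd := fun n => H1.memLp_deriv (hu n)
  have hdn : ∀ n, (G.lpPow 2 fun e => deriv (u n e)).toReal = ‖(hd n).toLp _‖ ^ 2 := fun n =>
    H1.toReal_lpPow_deriv (hu n)
  -- Initial values on all edges converge along one subsequence: a countable product of compact
  -- intervals is compact and metrizable.
  obtain ⟨a, -, φ₁, hφ₁, ha⟩ := (isCompact_univ_pi (s := fun _ : E => Icc (-M) M)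
    (fun _ => isCompact_Icc)).isSeqCompact (x := fun n e => u n e 0)
    (fun n e _ => abs_le.1 (hM n e 0 ⟨le_rfl, (G.len_pos e).le⟩))
  have ha' := tendsto_pi_nhds.1 ha
  obtain ⟨y, φ₂, hφ₂, hy⟩ := exists_subseq_tendsto_inner (x := fun n => (hd (φ₁ n)).toLp _)
    (C := √K) (fun n => Real.le_sqrt_of_sq_le (by rw [← hdn]; exact hK _))
  set φ := φ₁ ∘ φ₂ with hφ
  -- The limit is the primitive of the weak limit of the derivatives, so weak convergence of these
  -- gives pointwise convergence of the functions.
  set U : E → ℝ → ℝ := fun e x => a e + ∫ s in (0 : ℝ)..x, y (e, s) with hU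
  have hyL := Lp.memLp y
  have hyi : ∀ e, IntervalIntegrable (fun s => y (e, s)) volume 0 (G.len e) := by
    intro e
    rw [intervalIntegrable_iff_integrableOn_Ioo_of_le (G.len_pos e).le]
    exact (G.memLp_edge hyL e).integrable one_le_two
  have hpt : ∀ e, ∀ x ∈ Icc 0 (G.len e),
      Tendsto (fun n => u (φ n) e x) atTop (𝓝 (U e x)) := by
    intro e x hx
    have h1 := G.tendsto_integral_edge (fun n => hd (φ₁ (φ₂ n))) hy e hx.1 hx.2
    refine (((ha' e).comp hφ₂.tendsto_atTop).add h1).congr fun n => ?_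
    exact (H1.apply_eq_add_integral (hu _) e hx).symm
  have hUac : ∀ e, AbsolutelyContinuousOnInterval (U e) 0 (G.len e) := by
    intro e
    refine AbsolutelyContinuousOnInterval.add (f := fun _ => a e) ?_
      ((hyi e).absolutelyContinuousOnInterval_intervalIntegral left_mem_uIcc)
    exact contDiffOn_const.absolutelyContinuousOnInterval
  have hUd : ∀ e, deriv (U e) =ᵐ[volume.restrict (Ioo 0 (G.len e))] fun x => y (e, x) := by
    intro e
    rw [EventuallyEq, ae_restrict_iff' measurableSet_Ioo]
    filter_upwards [(hyi e).ae_hasDerivAt_integral] with x hx hx'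
    have hx'' : x ∈ uIcc 0 (G.len e) := by
      rw [uIcc_of_le (G.len_pos e).le]; exact Ioo_subset_Icc_self hx'
    exact ((hx hx'' 0 left_mem_uIcc).const_add (a e)).deriv
  have hUH : U ∈ G.H1 := by
    refine ⟨hUac, ?_, ?_, ?_⟩
    · choose ψ hψ using fun n => (hu n).2.1
      -- At a vertex of some edge this is a true limit; at an isolated vertex it may be a default
      -- value, which no condition involves.
      refine ⟨fun v => limUnder atTop fun n => ψ (φ n) v, fun e => ⟨?_, ?_⟩⟩
      · have := hpt e 0 ⟨le_rfl, (G.len_pos e).le⟩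
        simp only [(hψ _ e).1] at this
        exact this.limUnder_eq.symm
      · have := hpt e (G.len e) ⟨(G.len_pos e).le, le_rfl⟩
        simp only [(hψ _ e).2] at this
        exact this.limUnder_eq.symm
    · rw [lpPow_eq_lintegral]
      have hae : ∀ᵐ z ∂G.edgeMeasure, ‖U z.1 z.2‖ₑ ^ (2 : ℝ) =
          liminf (fun n => ‖u (φ n) z.1 z.2‖ₑ ^ (2 : ℝ)) atTop := by
        rw [ae_edgeMeasure_iff]
        intro e
        rw [ae_restrict_iff' measurableSet_Ioo]
        refine Eventually.of_forall fun x hx => ?_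
        exact ((hpt e x (Ioo_subset_Icc_self hx)).enorm.ennrpow_const 2).liminf_eq.symm
      rw [lintegral_congr_ae hae]
      refine (lintegral_liminf_le' fun n => ?_).trans_lt ?_
      · have := (H1.memLp (hu (φ n))).1.aemeasurable
        exact this.enorm.pow_const _
      · simp only [← lpPow_eq_lintegral]
        refine lt_of_le_of_lt ?_ (ENNReal.ofReal_lt_top (r := A))
        exact liminf_le_of_frequently_le' (Eventually.of_forall fun n => hA (φ n)).frequently
    · rw [G.lpPow_congr hUd]
      exact G.lpPow_two_lt_top_of_memLp (f := fun e x => y (e, x)) hyL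
  refine ⟨U, hUH, φ, hφ₁.comp hφ₂, hpt, ?_⟩
  have hUL := H1.memLp_deriv hUH
  have hUy : hUL.toLp _ = y := by
    rw [← Lp.toLp_coeFn y hyL]
    refine MemLp.toLp_congr _ _ (G.ae_edgeMeasure_iff.2 hUd)
  have hkU : (G.lpPow 2 fun e => deriv (U e)).toReal = ‖y‖ ^ 2 := by
    rw [H1.toReal_lpPow_deriv hUH, hUy]
  have hkd : ∀ n, (G.lpPow 2 fun e => deriv fun x => u (φ n) e x - U e x).toReal =
      ‖(hd (φ n)).toLp _ - y‖ ^ 2 := by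
    intro n
    rw [← hUy]
    exact H1.toReal_lpPow_deriv_sub (hu (φ n)) hUH
  rw [hkU]
  -- `‖x‖² - ‖x - y‖² = 2 ⟨x, y⟩ - ‖y‖²` is affine in `x`, so weak convergence suffices.
  have h1 := ((hy y).const_mul 2).sub_const (‖y‖ ^ 2)
  rw [real_inner_self_eq_norm_sq, show 2 * ‖y‖ ^ 2 - ‖y‖ ^ 2 = ‖y‖ ^ 2 by ring] at h1
  refine h1.congr fun n => ?_
  rw [hdn, hkd, norm_sub_sq_real]
  simp only [hφ, Function.comp]
  ring

/-- Splitting of the `L^q` integrals along a bounded sequence that converges pointwise. -/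
theorem H1.tendsto_lpPow_sub [Countable E] {u : ℕ → E → ℝ → ℝ} {U : E → ℝ → ℝ}
    (hu : ∀ n, u n ∈ G.H1) (hU : U ∈ G.H1) {M A q : ℝ} (hq : 2 ≤ q)
    (hM : ∀ n e, ∀ x ∈ Icc 0 (G.len e), |u n e x| ≤ M)
    (hA : ∀ n, (G.lpPow 2 (u n)).toReal ≤ A)
    (hlim : ∀ e, ∀ x ∈ Icc 0 (G.len e), Tendsto (fun n => u n e x) atTop (𝓝 (U e x))) :
    Tendsto (fun n => (G.lpPow q (u n)).toReal -
      (G.lpPow q fun e x => u n e x - U e x).toReal) atTop (𝓝 (G.lpPow q U).toReal) := by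
  let _ : MeasurableSpace E := ⊤
  have : DiscreteMeasurableSpace E := ⟨fun _ => trivial⟩
  have hUM : ∀ e, ∀ x ∈ Icc 0 (G.len e), |U e x| ≤ M := fun e x hx =>
    le_of_tendsto (hlim e x hx).abs (Eventually.of_forall fun n => hM n e x hx)
  have hdM : ∀ n e, ∀ x ∈ Icc 0 (G.len e), |u n e x - U e x| ≤ 2 * M := fun n e x hx =>
    (abs_sub _ _).trans (by linarith [hM n e x hx, hUM e x hx])
  have hs := fun n => H1.sub (hu n) hU
  have hae : ∀ {w : E × ℝ → Prop}, (∀ e, ∀ x ∈ Icc 0 (G.len e), w (e, x)) →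
      ∀ᵐ z ∂G.edgeMeasure, w z := by
    intro w hw
    rw [ae_edgeMeasure_iff]
    intro e
    rw [ae_restrict_iff' measurableSet_Ioo]
    exact Eventually.of_forall fun x hx => hw e x (Ioo_subset_Icc_self hx)
  have hfin : ∀ {w : E → ℝ → ℝ} {B : ℝ}, w ∈ G.H1 →
      (∀ e, ∀ x ∈ Icc 0 (G.len e), |w e x| ≤ B) →
      Integrable (fun z : E × ℝ => |w z.1 z.2| ^ q) G.edgeMeasure := by
    intro w B hw hB
    have hm := (H1.memLp hw).1.aemeasurable
    have hlt : G.lpPow q w < ∞ :=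
      (G.lpPow_le_of_bound hq fun e x hx => hB e x (Ioo_subset_Icc_self hx)).trans_lt
        (ENNReal.mul_lt_top ENNReal.ofReal_lt_top hw.2.2.1)
    refine ⟨(by fun_prop : AEMeasurable _ _).aestronglyMeasurable, ?_⟩
    rw [hasFiniteIntegral_iff_enorm]
    rw [lpPow_eq_lintegral] at hlt
    refine lt_of_eq_of_lt (lintegral_congr fun z => ?_) hlt
    rw [← ofReal_norm, ← ofReal_norm, ENNReal.ofReal_rpow_of_nonneg (norm_nonneg _) (by linarith),
      Real.norm_of_nonneg (by positivity), Real.norm_eq_abs]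
  have key := tendsto_integral_rpow_sub (ν := G.edgeMeasure) (f := fun n z => u n z.1 z.2)
    (g := fun z => U z.1 z.2) (M := M) (A := 2 * A + 2 * (G.lpPow 2 U).toReal) hq
    (fun n => H1.memLp (hu n)) (H1.memLp hU) (fun n => hae (hM n)) (hae hUM) (fun n => ?_)
    (hae hlim)
  · have key' := key.add_const (G.lpPow q U).toReal
    rw [zero_add] at key'
    refine key'.congr fun n => ?_
    have i1 := hfin (hu n) (hM n)
    have i2 := hfin (hs n) (hdM n)
    have i3 := hfin hU hUM
    have e := integral_sub (i1.sub i2) i3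
    simp only [Pi.sub_apply] at e
    rw [G.toReal_lpPow (by linarith) (H1.aestronglyMeasurable hU),
      G.toReal_lpPow (by linarith) (H1.aestronglyMeasurable (hu n)),
      G.toReal_lpPow (by linarith) (H1.aestronglyMeasurable (hs n)),
      e, integral_sub i1 i2]
    ring
  · refine (integral_sub_sq_le (H1.memLp (hu n)) (H1.memLp hU)).trans ?_
    rw [← G.toReal_lpPow_two (H1.aestronglyMeasurable (hu n)),
      ← G.toReal_lpPow_two (H1.aestronglyMeasurable hU)]
    linarith [hA n]

end MetricGraph

/-! ### Coercivity, rescaling of the mass, and non-vanishing. -/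

namespace MetricGraph

variable {V E : Type*} (G : MetricGraph V E)

/-- The mass `∫ |f|²` carried by the edge `e`. -/
noncomputable def edgeMass (f : E → ℝ → ℝ) (e : E) : ℝ≥0∞ :=
  ∫⁻ x in Ioo 0 (G.len e), ‖f e x‖ₑ ^ (2 : ℝ)

theorem edgeMass_le_lpPow (f : E → ℝ → ℝ) (e : E) : G.edgeMass f e ≤ G.lpPow 2 f :=
  ENNReal.le_tsum e

theorem edgeMass_eq_ofReal {f : E → ℝ → ℝ} {e : E} {m : ℝ≥0∞} (h : G.edgeMass f e ≤ m)
    (hm : m < ∞) (hf : AEStronglyMeasurable (f e) (volume.restrict (Ioo 0 (G.len e)))) :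
    IntegrableOn (fun x => f e x ^ 2) (Ioo 0 (G.len e)) ∧
      ∫ x in Ioo 0 (G.len e), f e x ^ 2 = (G.edgeMass f e).toReal := by
  have h2 : ∀ x, ‖f e x ^ 2‖ₑ = ‖f e x‖ₑ ^ (2 : ℝ) := fun x => by
    rw [enorm_pow, ENNReal.rpow_ofNat]
  have hi : IntegrableOn (fun x => f e x ^ 2) (Ioo 0 (G.len e)) := by
    refine ⟨hf.pow 2, ?_⟩
    rw [hasFiniteIntegral_iff_enorm]
    simp only [h2]
    exact h.trans_lt hm
  refine ⟨hi, ?_⟩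
  rw [integral_eq_lintegral_of_nonneg_ae (Eventually.of_forall fun x => sq_nonneg _) hi.1,
    edgeMass]
  congr 1
  refine lintegral_congr fun x => ?_
  rw [← h2, Real.enorm_of_nonneg (sq_nonneg _)]

variable {G}

theorem H1.sq_le {u : E → ℝ → ℝ} (hu : u ∈ G.H1) (e : E) {t : ℝ} (ht : 0 < t) {x : ℝ}
    (hx : x ∈ Icc 0 (G.len e)) :
    u e x ^ 2 ≤ (1 / G.len e + t) * (G.edgeMass u e).toReal +
      1 / t * (G.lpPow 2 fun e => deriv (u e)).toReal := by
  obtain ⟨-, h1⟩ := G.edgeMass_eq_ofReal (G.edgeMass_le_lpPow u e) hu.2.2.1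
    (H1.aestronglyMeasurable hu e)
  have hle := G.edgeMass_le_lpPow (fun e => deriv (u e)) e
  obtain ⟨h2, h3⟩ := G.edgeMass_eq_ofReal hle hu.2.2.2 (H1.aestronglyMeasurable_deriv u e)
  have h4 := (hu.1 e).sq_le_integral (G.len_pos e) h2 ht hx
  rw [h1, h3] at h4
  have h5 := ENNReal.toReal_mono hu.2.2.2.ne hle
  have : 0 < 1 / t := by positivity
  nlinarith

/-- The mass enters only edge by edge, which detects vanishing, and `t` remains free: it is `1` for
boundedness, `1 + √K` for coercivity, and proportional to `(K + 1) / z` for non-vanishing. -/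
theorem H1.sq_le_of_le {u : E → ℝ → ℝ} (hu : u ∈ G.H1) {ℓ δ K t : ℝ} (hℓ : 0 < ℓ)
    (hlen : ∀ e, ℓ ≤ G.len e) (ht : 0 < t) (hδ : ∀ e, (G.edgeMass u e).toReal ≤ δ)
    (hK : (G.lpPow 2 fun e => deriv (u e)).toReal ≤ K) (e : E) {x : ℝ}
    (hx : x ∈ Icc 0 (G.len e)) : u e x ^ 2 ≤ (1 / ℓ + t) * δ + 1 / t * K := by
  refine (H1.sq_le hu e ht hx).trans ?_
  have h1 : 1 / G.len e ≤ 1 / ℓ := one_div_le_one_div_of_le hℓ (hlen e)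
  have h0 : 0 ≤ 1 / G.len e := by have := G.len_pos e; positivity
  have h2 := hδ e
  gcongr

theorem H1.toReal_edgeMass_le {u : E → ℝ → ℝ} (hu : u ∈ G.H1) (e : E) :
    (G.edgeMass u e).toReal ≤ (G.lpPow 2 u).toReal :=
  ENNReal.toReal_mono hu.2.2.1.ne (G.edgeMass_le_lpPow u e)

theorem H1.exists_bound {ℓ : ℝ} (hℓ : 0 < ℓ) (hlen : ∀ e, ℓ ≤ G.len e) (A K : ℝ) :
    ∃ M, ∀ u ∈ G.H1, (G.lpPow 2 u).toReal ≤ A → (G.lpPow 2 fun e => deriv (u e)).toReal ≤ K →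
      ∀ e, ∀ x ∈ Icc 0 (G.len e), |u e x| ≤ M := by
  refine ⟨√((1 / ℓ + 1) * A + 1 / 1 * K), fun u hu hA hK e x hx => ?_⟩
  exact Real.abs_le_sqrt (H1.sq_le_of_le hu hℓ hlen one_pos
    (fun e => (H1.toReal_edgeMass_le hu e).trans hA) hK e hx)

theorem H1.lpPow_lt_top {ℓ : ℝ} (hℓ : 0 < ℓ) (hlen : ∀ e, ℓ ≤ G.len e) {q : ℝ} (hq : 2 ≤ q)
    {u : E → ℝ → ℝ} (hu : u ∈ G.H1) : G.lpPow q u < ∞ := by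
  obtain ⟨M, hM⟩ := H1.exists_bound (G := G) hℓ hlen _ _
  exact (G.lpPow_le_of_bound hq fun e x hx =>
    hM u hu le_rfl le_rfl e x (Ioo_subset_Icc_self hx)).trans_lt
    (ENNReal.mul_lt_top ENNReal.ofReal_lt_top hu.2.2.1)

/-- If the square of `u` is bounded by `z`, then `∫ |u|^q ≤ z ^ ((q - 2) / 2) ∫ |u|²`. -/
theorem H1.toReal_lpPow_le {q z : ℝ} (hq : 2 ≤ q) {u : E → ℝ → ℝ} (hu : u ∈ G.H1) (hz : 0 ≤ z)
    (h : ∀ e, ∀ x ∈ Icc 0 (G.len e), u e x ^ 2 ≤ z) :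
    (G.lpPow q u).toReal ≤ z ^ ((q - 2) / 2) * (G.lpPow 2 u).toReal := by
  have h1 := G.lpPow_le_of_bound (M := √z) hq fun e x hx =>
    Real.abs_le_sqrt (h e x (Ioo_subset_Icc_self hx))
  have h2 : √z ^ (q - 2) = z ^ ((q - 2) / 2) := by
    rw [Real.sqrt_eq_rpow, ← Real.rpow_mul hz]; congr 1; ring
  have h3 := ENNReal.toReal_mono (ENNReal.mul_lt_top ENNReal.ofReal_lt_top hu.2.2.1).ne h1
  rwa [ENNReal.toReal_mul, h2, ENNReal.toReal_ofReal (by positivity)] at h3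

variable (G) in
/-- The energy as a real number. -/
noncomputable def realEnergy (p : ℝ) (u : E → ℝ → ℝ) : ℝ :=
  (G.lpPow 2 fun e => deriv (u e)).toReal / 2 - (G.lpPow p u).toReal / p

theorem H1.energy_eq {p : ℝ} (hp : 0 < p) {u : E → ℝ → ℝ} (hu : u ∈ G.H1)
    (h : G.lpPow p u < ∞) : G.energy p u = (G.realEnergy p u : EReal) := by
  have h1 : G.lpPow 2 (fun e => deriv (u e)) / 2 ≠ ∞ := ENNReal.div_ne_top hu.2.2.2.ne (by simp)
  have h2 : G.lpPow p u / ENNReal.ofReal p ≠ ∞ := ENNReal.div_ne_top h.ne (by simpa using hp)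
  rw [energy, realEnergy, ← EReal.coe_ennreal_toReal h1, ← EReal.coe_ennreal_toReal h2,
    ← EReal.coe_sub, ENNReal.toReal_div, ENNReal.toReal_div, ENNReal.toReal_ofReal hp.le]
  simp

/-- In the subcritical case the energy controls the kinetic part. -/
theorem H1.exists_le_realEnergy {ℓ : ℝ} (hℓ : 0 < ℓ) (hlen : ∀ e, ℓ ≤ G.len e) {p : ℝ}
    (hp2 : 2 < p) (hp6 : p < 6) {μ : ℝ} (hμ : 0 < μ) :
    ∃ C, ∀ u ∈ G.H1, (G.lpPow 2 u).toReal ≤ μ →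
      (G.lpPow 2 fun e => deriv (u e)).toReal / 4 - C ≤ G.realEnergy p u := by
  -- With `t = 1 + √K`, this `c` gives `u² ≤ c (1 + √K)`.
  set c := (1 / ℓ + 1) * μ + μ + 1 with hc
  have hc0 : 0 < c := by positivity
  -- The exponent `(p - 2) / 2` is below `2` exactly when `p < 6`. The coefficient makes the
  -- potential term at most `(1 + √K)² / 8` plus a constant, hence at most `K / 4` plus a constant.
  obtain ⟨D, hD0, hD⟩ := exists_rpow_le_sq_add (s := (p - 2) / 2) (by linarith) (by linarith)
    (ε := p / (8 * μ * c ^ 2)) (by positivity)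
  refine ⟨1 / 4 + μ * D / p, fun u hu hA => ?_⟩
  set K := (G.lpPow 2 fun e => deriv (u e)).toReal with hK
  have hK0 : 0 ≤ K := ENNReal.toReal_nonneg
  have hs0 : 0 ≤ √K := Real.sqrt_nonneg K
  have hs2 : √K ^ 2 = K := Real.sq_sqrt hK0
  have hz : ∀ e, ∀ x ∈ Icc 0 (G.len e), u e x ^ 2 ≤ c * (1 + √K) := by
    intro e x hx
    refine (H1.sq_le_of_le hu hℓ hlen (t := 1 + √K) (by positivity)
      (fun e => (H1.toReal_edgeMass_le hu e).trans hA) hK.symm.le e hx).trans ?_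
    have h1 : 1 / (1 + √K) * K ≤ √K := by
      rw [div_mul_eq_mul_div, one_mul, div_le_iff₀ (by positivity)]
      nlinarith
    have h2 : 0 ≤ 1 / ℓ := by positivity
    have h3 : 0 ≤ 1 / ℓ * μ * √K := by positivity
    rw [hc]
    nlinarith
  have h1 := H1.toReal_lpPow_le hp2.le hu (by positivity) hz
  have h2 := hD (c * (1 + √K)) (by positivity)
  have h3 : (G.lpPow p u).toReal ≤ (p / (8 * μ * c ^ 2) * (c * (1 + √K)) ^ 2 + D) * μ :=
    h1.trans (mul_le_mul h2 hA ENNReal.toReal_nonneg (by positivity))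
  have h4 : (p / (8 * μ * c ^ 2) * (c * (1 + √K)) ^ 2 + D) * μ = p / 8 * (1 + √K) ^ 2 + μ * D := by
    field_simp
  rw [h4] at h3
  have h5 : (G.lpPow p u).toReal / p ≤ 1 / 8 * (1 + √K) ^ 2 + μ * D / p := by
    rw [div_le_iff₀ (by linarith)]
    have : (1 / 8 * (1 + √K) ^ 2 + μ * D / p) * p = p / 8 * (1 + √K) ^ 2 + μ * D := by
      field_simp
    linarith
  rw [realEnergy, ← hK]
  nlinarith [sq_nonneg (1 - √K)]

theorem realEnergy_const_mul {p : ℝ} (hp : 0 ≤ p) {c : ℝ} (hc : 0 ≤ c) (u : E → ℝ → ℝ) :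
    G.realEnergy p (fun e x => c * u e x) =
      c ^ 2 * (G.lpPow 2 fun e => deriv (u e)).toReal / 2 - c ^ p * (G.lpPow p u).toReal / p := by
  rw [realEnergy, H1.lpPow_deriv_const_mul, G.lpPow_const_mul hp, ENNReal.toReal_mul,
    ENNReal.toReal_mul, ENNReal.toReal_ofReal (by positivity),
    ENNReal.toReal_ofReal (by positivity),
    abs_of_nonneg hc]

/-- Rescaling a non-zero function to the mass `μ`. -/
theorem H1.exists_rescale {p μ : ℝ} (hp : 0 ≤ p) (hμ : 0 < μ) {w : E → ℝ → ℝ} (hw : w ∈ G.H1)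
    (hw0 : 0 < (G.lpPow 2 w).toReal) :
    ∃ v ∈ G.H1Mass μ, G.realEnergy p v =
      μ / (G.lpPow 2 w).toReal * (G.lpPow 2 fun e => deriv (w e)).toReal / 2 -
        (μ / (G.lpPow 2 w).toReal) ^ (p / 2) * (G.lpPow p w).toReal / p := by
  set m := (G.lpPow 2 w).toReal with hm
  have hr : 0 ≤ μ / m := by positivity
  refine ⟨fun e x => √(μ / m) * w e x, ⟨H1.const_mul hw _, ?_⟩, ?_⟩
  · rw [G.lpPow_const_mul (by norm_num), ← ENNReal.ofReal_toReal hw.2.2.1.ne, ← hm,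
      ← ENNReal.ofReal_mul (by positivity)]
    congr 1
    rw [abs_of_nonneg (Real.sqrt_nonneg _), Real.rpow_two, Real.sq_sqrt hr]
    field_simp
  · rw [realEnergy_const_mul hp (Real.sqrt_nonneg _), Real.sq_sqrt hr]
    congr 3
    rw [Real.sqrt_eq_rpow, ← Real.rpow_mul hr]
    congr 1; ring

/-- If `I` bounds the energy from below at the mass `μ`, then at a smaller mass `m` the energy is
at least `(m / μ) I`. -/
theorem H1.mul_le_realEnergy {ℓ : ℝ} (hℓ : 0 < ℓ) (hlen : ∀ e, ℓ ≤ G.len e) {p μ I : ℝ}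
    (hp2 : 2 < p) (hμ : 0 < μ) (hI : ∀ v ∈ G.H1Mass μ, I ≤ G.realEnergy p v) {w : E → ℝ → ℝ}
    (hw : w ∈ G.H1) (hwμ : (G.lpPow 2 w).toReal ≤ μ) :
    (G.lpPow 2 w).toReal / μ * I ≤ G.realEnergy p w := by
  set m := (G.lpPow 2 w).toReal with hm
  have hm0 : 0 ≤ m := ENNReal.toReal_nonneg
  -- A function of zero mass cannot be rescaled; its potential term vanishes and its energy is
  -- nonnegative.
  rcases hm0.eq_or_lt with h | h
  · obtain ⟨M, hM⟩ := H1.exists_bound (G := G) hℓ hlen _ _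
    have h0 := H1.toReal_lpPow_le hp2.le hw (sq_nonneg M) fun e x hx =>
      sq_le_sq' (neg_le_of_abs_le (hM w hw le_rfl le_rfl e x hx))
        (le_of_abs_le (hM w hw le_rfl le_rfl e x hx))
    rw [← hm, ← h, mul_zero] at h0
    rw [← h, zero_div, zero_mul, realEnergy, le_antisymm h0 ENNReal.toReal_nonneg,
      zero_div, sub_zero]
    positivity
  · obtain ⟨v, hv, hve⟩ := H1.exists_rescale (p := p) (by linarith) hμ hw h
    have h1 := hI v hv
    rw [hve, ← hm] at h1
    -- Raising the mass multiplies the kinetic term by `μ / m` but the potential term by the larger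
    -- factor `(μ / m) ^ (p / 2)`.
    have h2 : μ / m ≤ (μ / m) ^ (p / 2) :=
      Real.self_le_rpow_of_one_le ((one_le_div h).2 hwμ) (by linarith)
    have hP : 0 ≤ (G.lpPow p w).toReal / p := div_nonneg ENNReal.toReal_nonneg (by linarith)
    have h3 : I ≤ μ / m * G.realEnergy p w := by
      refine h1.trans ?_
      rw [realEnergy, mul_sub, mul_div_assoc, mul_div_assoc]
      have := mul_le_mul_of_nonneg_right h2 hP
      linarith
    calc m / μ * I ≤ m / μ * (μ / m * G.realEnergy p w) := by gcongr
      _ = G.realEnergy p w := by field_simp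

/-- If `I < 0`, the bound of `H1.mul_le_realEnergy` is not attained at masses in `(0, μ)`. -/
theorem H1.mul_lt_realEnergy {p μ I : ℝ} (hp2 : 2 < p) (hμ : 0 < μ) (hI0 : I < 0)
    (hI : ∀ v ∈ G.H1Mass μ, I ≤ G.realEnergy p v) {w : E → ℝ → ℝ} (hw : w ∈ G.H1)
    (hwμ : (G.lpPow 2 w).toReal < μ) (h : 0 < (G.lpPow 2 w).toReal) :
    (G.lpPow 2 w).toReal / μ * I < G.realEnergy p w := by
  set m := (G.lpPow 2 w).toReal with hm
  -- Strictness comes from the potential term when it is positive, and from `I < 0` when it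
  -- vanishes.
  rcases (ENNReal.toReal_nonneg : 0 ≤ (G.lpPow p w).toReal).eq_or_lt with h' | h'
  · have h1 : m / μ * I < 0 := mul_neg_of_pos_of_neg (by positivity) hI0
    rw [realEnergy, ← h', zero_div, sub_zero]
    exact h1.trans_le (by positivity)
  · obtain ⟨v, hv, hve⟩ := H1.exists_rescale (p := p) (by linarith) hμ hw h
    have h1 := hI v hv
    rw [hve, ← hm] at h1
    have h2 : μ / m < (μ / m) ^ (p / 2) :=
      Real.self_lt_rpow_of_one_lt ((one_lt_div h).2 hwμ) (by linarith)
    have hP : 0 < (G.lpPow p w).toReal / p := div_pos h' (by linarith)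
    have h3 : I < μ / m * G.realEnergy p w := by
      refine h1.trans_lt ?_
      rw [realEnergy, mul_sub, mul_div_assoc, mul_div_assoc]
      have := mul_lt_mul_of_pos_right h2 hP
      linarith
    calc m / μ * I < m / μ * (μ / m * G.realEnergy p w) := by gcongr
      _ = G.realEnergy p w := by field_simp

/-- A function with small mass on every edge has small `L^p` integral. -/
theorem H1.exists_edgeMass_gt {ℓ : ℝ} (hℓ : 0 < ℓ) (hlen : ∀ e, ℓ ≤ G.len e) {p : ℝ}
    (hp2 : 2 < p) {μ K c : ℝ} (hK0 : 0 ≤ K) (hc : 0 < c) :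
    ∃ δ > 0, ∀ u ∈ G.H1, (G.lpPow 2 u).toReal ≤ μ →
      (G.lpPow 2 fun e => deriv (u e)).toReal ≤ K → c ≤ (G.lpPow p u).toReal →
      ∃ e, δ < (G.edgeMass u e).toReal := by
  set s := (p - 2) / 2 with hs
  have hs0 : 0 < s := by linarith
  have h1 : Tendsto (fun z : ℝ => z ^ s * μ) (𝓝[>] 0) (𝓝 0) := by
    have : Tendsto (fun z : ℝ => z ^ s * μ) (𝓝 0) (𝓝 (0 ^ s * μ)) :=
      (Real.continuousAt_rpow_const 0 s (Or.inr hs0.le)).tendsto.mul_const μ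
    rw [Real.zero_rpow hs0.ne', zero_mul] at this
    exact this.mono_left nhdsWithin_le_nhds
  obtain ⟨z, hzc, hz⟩ := ((h1.eventually (gt_mem_nhds hc)).and self_mem_nhdsWithin).exists
  have hz0 : 0 < z := hz
  -- `t` and `δ` are such that the kinetic and mass parts of the bound on `u²` are each at most `z /
  -- 2`, while `z ^ s * μ < c`.
  set t := 2 * (K + 1) / z with ht
  have ht0 : 0 < t := by positivity
  set δ := z / (2 * (1 / ℓ + t)) with hδ
  have hδ0 : 0 < δ := by positivity
  refine ⟨δ, hδ0, fun u hu hA hK hP => ?_⟩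
  by_contra! hcon
  have h2 : ∀ e, ∀ x ∈ Icc 0 (G.len e), u e x ^ 2 ≤ z := by
    intro e x hx
    refine (H1.sq_le_of_le hu hℓ hlen ht0 hcon hK e hx).trans ?_
    have e1 : (1 / ℓ + t) * δ = z / 2 := by rw [hδ]; field_simp
    have e2 : 1 / t * K ≤ z / 2 := by
      rw [ht, one_div_div, div_mul_eq_mul_div, div_le_div_iff₀ (by positivity) (by norm_num)]
      nlinarith
    linarith
  have h3 := H1.toReal_lpPow_le hp2.le hu hz0.le h2
  have h4 : z ^ s * (G.lpPow 2 u).toReal ≤ z ^ s * μ := by gcongr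
  rw [← hs] at h3
  linarith

/-- The mass of an edge is continuous along a bounded sequence that converges pointwise. -/
theorem H1.tendsto_edgeMass {u : ℕ → E → ℝ → ℝ} {U : E → ℝ → ℝ}
    (hu : ∀ n, u n ∈ G.H1) {M : ℝ}
    (hM : ∀ n e, ∀ x ∈ Icc 0 (G.len e), |u n e x| ≤ M)
    (hlim : ∀ e, ∀ x ∈ Icc 0 (G.len e), Tendsto (fun n => u n e x) atTop (𝓝 (U e x))) (e : E) :
    Tendsto (fun n => G.edgeMass (u n) e) atTop (𝓝 (G.edgeMass U e)) := by
  refine tendsto_lintegral_of_dominated_convergence' (fun _ => ENNReal.ofReal M ^ (2 : ℝ))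
    (fun n => (H1.aestronglyMeasurable (hu n) e).aemeasurable.enorm.pow_const _)
    (fun n => ?_) ?_ ?_
  · rw [EventuallyLE, ae_restrict_iff' measurableSet_Ioo]
    refine Eventually.of_forall fun x hx => ?_
    rw [← ofReal_norm, Real.norm_eq_abs]
    gcongr
    exact hM n e x (Ioo_subset_Icc_self hx)
  · rw [lintegral_const]
    exact ENNReal.mul_ne_top (by simp) (by simp)
  · rw [ae_restrict_iff' measurableSet_Ioo]
    exact Eventually.of_forall fun x hx =>
      (hlim e x (Ioo_subset_Icc_self hx)).enorm.ennrpow_const 2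

end MetricGraph

/-! ### Convergence of non-vanishing minimizing sequences. -/

namespace MetricGraph

section Minimizer

variable {V E : Type*} {G : MetricGraph V E}

/-- A minimizing sequence whose mass does not escape from a finite set of edges has a subsequence
converging to a minimizer. -/
theorem H1Mass.exists_realEnergy_le [Countable E] {ℓ : ℝ} (hℓ : 0 < ℓ) (hlen : ∀ e, ℓ ≤ G.len e)
    {p μ I : ℝ} (hp2 : 2 < p) (hp6 : p < 6) (hμ : 0 < μ) (hI0 : I < 0)
    (hI : ∀ v ∈ G.H1Mass μ, I ≤ G.realEnergy p v) {u : ℕ → E → ℝ → ℝ}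
    (hu : ∀ n, u n ∈ G.H1Mass μ)
    (hE : Tendsto (fun n => G.realEnergy p (u n)) atTop (𝓝 I)) {S : Finset E} {δ : ℝ} (hδ : 0 < δ)
    (hS : ∀ n, ∃ e ∈ S, δ < (G.edgeMass (u n) e).toReal) :
    ∃ U ∈ G.H1Mass μ, G.realEnergy p U ≤ I := by
  obtain ⟨B, hB⟩ := hE.bddAbove_range
  obtain ⟨C, hC⟩ := H1.exists_le_realEnergy hℓ hlen hp2 hp6 hμ
  have hA : ∀ n, (G.lpPow 2 (u n)).toReal = μ := fun n => by
    rw [(hu n).2, ENNReal.toReal_ofReal hμ.le]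
  have hK : ∀ n, (G.lpPow 2 fun e => deriv (u n e)).toReal ≤ 4 * (B + C) := fun n => by
    have h1 := hC (u n) (hu n).1 (hA n).le
    have h2 := hB (mem_range_self n)
    linarith
  obtain ⟨M, hM⟩ := H1.exists_bound (G := G) hℓ hlen μ (4 * (B + C))
  have hM' := fun n => hM (u n) (hu n).1 (hA n).le (hK n)
  obtain ⟨U, hU, φ, hφ, hpt, hkin⟩ := H1.exists_subseq_tendsto (fun n => (hu n).1) hM'
    (fun n => (hu n).2.le) hK
  have hu' := fun n => (hu (φ n)).1
  have hmass := H1.tendsto_lpPow_sub (q := 2) hu' hU le_rfl (fun n => hM' (φ n))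
    (fun n => (hA (φ n)).le) hpt
  have hpot := H1.tendsto_lpPow_sub (q := p) hu' hU hp2.le (fun n => hM' (φ n))
    (fun n => (hA (φ n)).le) hpt
  simp only [hA] at hmass
  set m := (G.lpPow 2 U).toReal with hm
  set d : ℕ → ℝ := fun n => (G.lpPow 2 fun e x => u (φ n) e x - U e x).toReal with hd
  have hdm : Tendsto d atTop (𝓝 (μ - m)) := by
    simpa using hmass.const_sub μ
  have hmμ : m ≤ μ := by
    have := ge_of_tendsto' hdm fun n => ENNReal.toReal_nonneg
    linarith
  -- The mass on the finite set `S` passes to the limit and stays at least `δ`.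
  have hm0 : 0 < m := by
    have h1 : Tendsto (fun n => ∑ e ∈ S, (G.edgeMass (u (φ n)) e).toReal) atTop
        (𝓝 (∑ e ∈ S, (G.edgeMass U e).toReal)) := by
      refine tendsto_finsetSum _ fun e _ => ?_
      refine (ENNReal.tendsto_toReal ?_).comp
        (H1.tendsto_edgeMass hu' (fun n => hM' (φ n)) hpt e)
      exact ((G.edgeMass_le_lpPow U e).trans_lt hU.2.2.1).ne
    have h2 : δ ≤ ∑ e ∈ S, (G.edgeMass U e).toReal := by
      refine ge_of_tendsto' h1 fun n => ?_
      obtain ⟨e, he, hlt⟩ := hS (φ n)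
      exact hlt.le.trans (Finset.single_le_sum
        (f := fun e => (G.edgeMass (u (φ n)) e).toReal) (fun _ _ => ENNReal.toReal_nonneg) he)
    obtain ⟨e, -, he⟩ := Finset.exists_ne_zero_of_sum_ne_zero (hδ.trans_le h2).ne'
    exact (ENNReal.toReal_nonneg.lt_of_ne he.symm).trans_le (H1.toReal_edgeMass_le hU e)
  have hen : Tendsto (fun n => G.realEnergy p fun e x => u (φ n) e x - U e x) atTop
      (𝓝 (I - G.realEnergy p U)) := by
    have h1 := (hE.comp hφ.tendsto_atTop).sub ((hkin.div_const 2).sub (hpot.div_const p))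
    refine h1.congr fun n => ?_
    simp only [realEnergy, Function.comp]
    ring
  -- Since `m > 0`, the remainders eventually have mass below `μ`, so the rescaling bound applies to
  -- them.
  have hlow : (μ - m) / μ * I ≤ I - G.realEnergy p U := by
    refine le_of_tendsto_of_tendsto ((hdm.div_const μ).mul_const I) hen ?_
    filter_upwards [hdm.eventually (gt_mem_nhds (sub_lt_self μ hm0))] with n hn
    exact H1.mul_le_realEnergy hℓ hlen hp2 hμ hI (H1.sub (hu' n) hU) hn.le
  have hUE : G.realEnergy p U ≤ m / μ * I := by
    have : (μ - m) / μ * I = I - m / μ * I := by field_simp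
    linarith
  have hmeq : m = μ := by
    by_contra hne
    have := H1.mul_lt_realEnergy hp2 hμ hI0 hI hU (lt_of_le_of_ne hmμ hne) hm0
    linarith
  refine ⟨U, ⟨hU, ?_⟩, ?_⟩
  · rw [← ENNReal.ofReal_toReal hU.2.2.1.ne, ← hm, hmeq]
  · rwa [hmeq, div_self hμ.ne', one_mul] at hUE

end Minimizer

/-! ### Translations and cellwise interpolated functions on the periodic graph. -/

section Periodic

variable {V E : Type*} {K : MetricGraph V E} {P : PastingRule V}

/-- The translate by `k` periods of a function on a periodic graph. -/
def translate (k : ℤ) (u : ℤ × E → ℝ → ℝ) : ℤ × E → ℝ → ℝ := fun a => u (a.1 + k, a.2)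

theorem lpPow_translate (q : ℝ) (k : ℤ) (u : ℤ × E → ℝ → ℝ) :
    (K.periodic P).lpPow q (translate k u) = (K.periodic P).lpPow q u :=
  ((Equiv.addRight k).prodCongr (Equiv.refl E)).tsum_eq
    fun a => ∫⁻ x in Ioo 0 (K.len a.2), ‖u a x‖ₑ ^ q

theorem lpPow_deriv_translate (k : ℤ) (u : ℤ × E → ℝ → ℝ) :
    (K.periodic P).lpPow 2 (fun a => deriv (translate k u a)) =
      (K.periodic P).lpPow 2 fun a => deriv (u a) :=
  lpPow_translate 2 k fun a => deriv (u a)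

theorem realEnergy_translate (p : ℝ) (k : ℤ) (u : ℤ × E → ℝ → ℝ) :
    (K.periodic P).realEnergy p (translate k u) = (K.periodic P).realEnergy p u := by
  rw [realEnergy, lpPow_deriv_translate, lpPow_translate, realEnergy]

theorem translate_mem_H1 {u : ℤ × E → ℝ → ℝ} (hu : u ∈ (K.periodic P).H1) (k : ℤ) :
    translate k u ∈ (K.periodic P).H1 := by
  refine ⟨fun a => hu.1 (a.1 + k, a.2), ?_, ?_, ?_⟩
  · obtain ⟨φ, hφ⟩ := hu.2.1
    refine ⟨fun v => φ (Quotient.map (fun a : ℤ × V => (a.1 + k, a.2)) ?_ v), fun a =>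
      hφ (a.1 + k, a.2)⟩
    have hg : ∀ {a b : ℤ × V}, P.Glues a b → P.Glues (a.1 + k, a.2) (b.1 + k, b.2) :=
      fun h => ⟨by have := h.1; simp only; omega, h.2⟩
    rintro a b (h | h | h)
    · exact Or.inl (by rw [h])
    · exact Or.inr (Or.inl (hg h))
    · exact Or.inr (Or.inr (hg h))
  · rw [lpPow_translate]; exact hu.2.2.1
  · rw [lpPow_deriv_translate]; exact hu.2.2.2

open Classical in
/-- The values at the vertices of a function that is determined by one value `f i` for the
`i`-th copy of the cell; the receivers carry the value of the preceding copy. -/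
noncomputable def cellValue (P : PastingRule V) (f : ℤ → ℝ) (a : ℤ × V) : ℝ :=
  if a.2 ∈ P.receivers then f (a.1 - 1) else f a.1

theorem cellValue_eq_or (P : PastingRule V) (f : ℤ → ℝ) (a : ℤ × V) :
    cellValue P f a = f a.1 ∨ cellValue P f a = f (a.1 - 1) := by
  unfold cellValue; split_ifs <;> simp

/-- A donor in copy `i` is not a receiver, so it has the value `f i`; its partner is a receiver in
copy `i + 1` and takes the value of the copy before, again `f i`. -/
theorem cellValue_eq_of_glues {f : ℤ → ℝ} {a b : ℤ × V} (h : P.Glues a b) :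
    cellValue P f a = cellValue P f b := by
  have h1 : a.2 ∉ P.receivers := Set.disjoint_left.mp P.disjoint h.mem_left
  rw [cellValue, cellValue, if_neg h1, if_pos h.mem_right, h.1, add_sub_cancel_right]

/-- The edgewise affine interpolation of `cellValue`. -/
noncomputable def cellFun (K : MetricGraph V E) (P : PastingRule V) (f : ℤ → ℝ) :
    ℤ × E → ℝ → ℝ := fun a x =>
  cellValue P f (a.1, K.src a.2) +
    (cellValue P f (a.1, K.tgt a.2) - cellValue P f (a.1, K.src a.2)) / K.len a.2 * x

theorem deriv_cellFun (f : ℤ → ℝ) (a : ℤ × E) (x : ℝ) :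
    deriv (cellFun K P f a) x =
      (cellValue P f (a.1, K.tgt a.2) - cellValue P f (a.1, K.src a.2)) / K.len a.2 := by
  unfold cellFun
  simp

theorem cellFun_mem_H1 {f : ℤ → ℝ} (h : (K.periodic P).lpPow 2 (cellFun K P f) < ∞)
    (h' : (K.periodic P).lpPow 2 (fun a => deriv (cellFun K P f a)) < ∞) :
    cellFun K P f ∈ (K.periodic P).H1 := by
  refine ⟨fun a => ?_, ⟨Quotient.lift (cellValue P f) ?_, fun a => ⟨?_, ?_⟩⟩, h, h'⟩
  · refine ContDiffOn.absolutelyContinuousOnInterval ?_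
    unfold cellFun
    fun_prop
  · rintro a b (h | h | h)
    · rw [h]
    · exact cellValue_eq_of_glues h
    · exact (cellValue_eq_of_glues h).symm
  · simp [cellFun, periodic]
  · have := (K.len_pos a.2).ne'
    simp only [cellFun, periodic, Quotient.lift_mk]
    field_simp
    ring

theorem lpPow_periodic_le [Fintype E] {q B : ℝ} (hq : 0 < q) (hB : 0 ≤ B) {T : Finset ℤ}
    {g : ℤ × E → ℝ → ℝ} (hT : ∀ a, a.1 ∉ T → ∀ x, g a x = 0)
    (hg : ∀ a, ∀ x ∈ Ioo 0 (K.len a.2), |g a x| ≤ B) :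
    (K.periodic P).lpPow q g ≤ ENNReal.ofReal (T.card * (B ^ q * ∑ e, K.len e)) := by
  rw [lpPow, tsum_eq_sum (s := T ×ˢ Finset.univ)]
  · have h1 : ∀ a ∈ T ×ˢ (Finset.univ : Finset E),
        ∫⁻ x in Ioo 0 ((K.periodic P).len a), ‖g a x‖ₑ ^ q ≤
          ENNReal.ofReal (B ^ q * K.len a.2) := by
      intro a _
      calc _ ≤ ∫⁻ _ in Ioo 0 (K.len a.2), ENNReal.ofReal (B ^ q) := by
            refine setLIntegral_mono' measurableSet_Ioo fun x hx => ?_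
            rw [← ENNReal.ofReal_rpow_of_nonneg hB hq.le, ← ofReal_norm]
            gcongr
            exact hg a x hx
        _ = _ := by
            rw [setLIntegral_const, Real.volume_Ioo, sub_zero, ENNReal.ofReal_mul (by positivity)]
    refine (Finset.sum_le_sum h1).trans_eq ?_
    rw [← ENNReal.ofReal_sum_of_nonneg
      (fun a _ => mul_nonneg (by positivity) (K.len_pos a.2).le), Finset.sum_product]
    simp [Finset.mul_sum]
  · intro a ha
    have : a.1 ∉ T := fun h => ha (by simp [h])
    simp [hT a this, hq]

theorem le_lpPow_periodic {q : ℝ} {T : Finset ℤ} {g : ℤ × E → ℝ → ℝ} (e : E)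
    (hg : ∀ i ∈ T, ∀ x, g (i, e) x = 1) :
    ENNReal.ofReal (T.card * K.len e) ≤ (K.periodic P).lpPow q g := by
  refine le_trans ?_ (ENNReal.sum_le_tsum (T ×ˢ {e}))
  rw [Finset.sum_product]
  have : ∀ i ∈ T, ∑ e ∈ ({e} : Finset E), ∫⁻ x in Ioo 0 ((K.periodic P).len (i, e)),
      ‖g (i, e) x‖ₑ ^ q = ENNReal.ofReal (K.len e) := by
    intro i hi
    simp [hg i hi, periodic]
  rw [Finset.sum_congr rfl this, Finset.sum_const, ENNReal.ofReal_mul (by positivity)]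
  simp

/-- The cut-off function equal to `1` for `|i| ≤ N` and to `0` for `|i| ≥ 2 N`. -/
noncomputable def cutoff (N : ℕ) (i : ℤ) : ℝ := max 0 (min 1 (2 - |(i : ℝ)| / N))

theorem cutoff_eq_one {N : ℕ} {i : ℤ} (hi : |i| ≤ N) : cutoff N i = 1 := by
  have h : |(i : ℝ)| ≤ N := by exact_mod_cast hi
  have : |(i : ℝ)| / N ≤ 1 := div_le_one_of_le₀ h (by positivity)
  rw [cutoff, min_eq_left (by linarith), max_eq_right (by norm_num)]

theorem cutoff_eq_zero {N : ℕ} (hN : 0 < N) {i : ℤ} (hi : 2 * N ≤ |i|) : cutoff N i = 0 := by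
  have h : (2 : ℝ) * N ≤ |(i : ℝ)| := by exact_mod_cast hi
  have : 2 ≤ |(i : ℝ)| / N := by rw [le_div_iff₀ (by positivity)]; exact h
  rw [cutoff, max_eq_left]
  exact (min_le_right _ _).trans (by linarith)

theorem cutoff_nonneg (N : ℕ) (i : ℤ) : 0 ≤ cutoff N i := le_max_left _ _

theorem cutoff_le_one (N : ℕ) (i : ℤ) : cutoff N i ≤ 1 :=
  max_le zero_le_one (min_le_left _ _)

theorem abs_cutoff_sub_le (N : ℕ) (i : ℤ) : |cutoff N i - cutoff N (i - 1)| ≤ 1 / N := by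
  unfold cutoff
  have h1 : |(2 - |(i : ℝ)| / N) - (2 - |((i - 1 : ℤ) : ℝ)| / N)| ≤ 1 / N := by
    have : (2 - |(i : ℝ)| / N) - (2 - |((i - 1 : ℤ) : ℝ)| / N) =
        (|((i - 1 : ℤ) : ℝ)| - |(i : ℝ)|) / N := by ring
    rw [this, abs_div, Nat.abs_cast]
    gcongr
    refine (abs_abs_sub_abs_le_abs_sub _ _).trans ?_
    simp
  refine le_trans ?_ h1
  have h2 : ∀ a b : ℝ, |max 0 a - max 0 b| ≤ |a - b| := fun a b => by
    simpa using abs_max_sub_max_le_max 0 a 0 b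
  have h3 : ∀ a b : ℝ, |min 1 a - min 1 b| ≤ |a - b| := fun a b => by
    simpa using abs_min_sub_min_le_max 1 a 1 b
  exact (h2 _ _).trans (h3 _ _)

end Periodic

end MetricGraph

/-! ### Negative energy at every mass. -/

namespace MetricGraph

variable {V E : Type*} {K : MetricGraph V E} {P : PastingRule V}

theorem abs_cellValue_sub_le (N : ℕ) (i : ℤ) (v w : V) :
    |cellValue P (cutoff N) (i, v) - cellValue P (cutoff N) (i, w)| ≤ 1 / N := by
  have h := abs_cutoff_sub_le N i
  have h' := h
  rw [abs_sub_comm] at h'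
  have h0 : (0 : ℝ) ≤ 1 / N := by positivity
  rcases cellValue_eq_or P (cutoff N) (i, v) with h1 | h1 <;>
  rcases cellValue_eq_or P (cutoff N) (i, w) with h2 | h2 <;>
  rw [h1, h2] <;> simp only [sub_self, abs_zero] <;> assumption

theorem cellFun_cutoff_mem_Icc (N : ℕ) (a : ℤ × E) {x : ℝ} (hx : x ∈ Ioo 0 (K.len a.2)) :
    cellFun K P (cutoff N) a x ∈ Icc (0 : ℝ) 1 := by
  have hv : ∀ b : ℤ × V, cellValue P (cutoff N) b ∈ Icc (0 : ℝ) 1 := fun b => by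
    rcases cellValue_eq_or P (cutoff N) b with h | h <;> rw [h] <;>
    exact ⟨cutoff_nonneg _ _, cutoff_le_one _ _⟩
  have hℓ := K.len_pos a.2
  have := (convex_Icc (0 : ℝ) 1) (hv (a.1, K.src a.2)) (hv (a.1, K.tgt a.2))
    (a := 1 - x / K.len a.2) (b := x / K.len a.2)
    (sub_nonneg.2 ((div_le_one hℓ).2 hx.2.le)) (div_nonneg hx.1.le hℓ.le) (by ring)
  convert this using 1
  simp only [cellFun, smul_eq_mul]
  ring

/-- In the subcritical case there are functions of negative energy at every mass. -/
theorem exists_realEnergy_neg [Finite E] [Nonempty E] {p μ : ℝ} (hp2 : 2 < p) (hp6 : p < 6)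
    (hμ : 0 < μ) : ∃ v ∈ (K.periodic P).H1Mass μ, (K.periodic P).realEnergy p v < 0 := by
  have := Fintype.ofFinite E
  obtain ⟨e₀, he₀⟩ := Finite.exists_min K.len
  set ℓ := K.len e₀ with hℓ
  have hℓ0 : 0 < ℓ := K.len_pos e₀
  set L := ∑ e, K.len e with hL
  have hL0 : 0 < L := Finset.sum_pos (fun e _ => K.len_pos e) Finset.univ_nonempty
  set s := p / 2 - 1 with hs
  set b := μ / (6 * L) with hb
  have hb0 : 0 < b := by positivity
  -- `N ^ (2 - s) > c` is the inequality `hkey`: kinetic part `3 L / (ℓ² N)` below potential part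
  -- `(b / N) ^ s * N * ℓ / p`, both after division by the mass factor `r ≥ b / N`. Here `2 - s > 0`
  -- because `p < 6`.
  set c := 3 * L / ℓ ^ 2 * p / (b ^ s * ℓ) with hc
  have hlim : Tendsto (fun N : ℕ => (N : ℝ) ^ (2 - s)) atTop atTop :=
    (tendsto_rpow_atTop (by linarith)).comp tendsto_natCast_atTop_atTop
  obtain ⟨N, hNc, hN⟩ := ((hlim.eventually_gt_atTop c).and (eventually_gt_atTop 0)).exists
  have hN0 : (0 : ℝ) < N := by exact_mod_cast hN
  have hN1 : (1 : ℝ) ≤ N := by exact_mod_cast hN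
  set w := cellFun K P (cutoff N) with hw
  -- One extra cell on the right, because vertices of copy `i` may carry the value of index `i - 1`.
  -- For the same reason the plateau below is taken over `1 ≤ i ≤ N`.
  set T : Finset ℤ := Finset.Icc (-(2 * N)) (2 * N + 1) with hT
  have hTc : (T.card : ℝ) ≤ 6 * N := by
    have : (T.card : ℤ) = 4 * N + 2 := by
      rw [hT, Int.card_Icc, Int.toNat_of_nonneg (by omega)]; ring
    have h' : (T.card : ℝ) = 4 * N + 2 := by exact_mod_cast this
    linarith
  have hT0 : ∀ i ∉ T, ∀ v, cellValue P (cutoff N) (i, v) = 0 := by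
    intro i hi v
    rw [hT, Finset.mem_Icc, not_and_or] at hi
    rcases cellValue_eq_or P (cutoff N) (i, v) with h | h <;> rw [h] <;>
    · refine cutoff_eq_zero hN ?_
      simp only
      rw [le_abs]
      omega
  have hT1 : ∀ i ∈ Finset.Icc (1 : ℤ) N, ∀ v, cellValue P (cutoff N) (i, v) = 1 := by
    intro i hi v
    rw [Finset.mem_Icc] at hi
    rcases cellValue_eq_or P (cutoff N) (i, v) with h | h <;> rw [h] <;>
    · refine cutoff_eq_one ?_
      simp only
      rw [abs_le]
      omega
  have hmass := lpPow_periodic_le (K := K) (P := P) (q := 2) (by norm_num) zero_le_one (T := T)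
    (g := w) (fun a ha x => by simp [hw, cellFun, hT0 a.1 ha])
    (fun a x hx => by
      have := cellFun_cutoff_mem_Icc (K := K) (P := P) N a hx
      rw [abs_of_nonneg this.1]; exact this.2)
  have hkin := lpPow_periodic_le (K := K) (P := P) (q := 2) (B := 1 / N / ℓ) (by norm_num)
    (by positivity) (T := T) (g := fun a => deriv (w a))
    (fun a ha x => by rw [deriv_cellFun, hT0 a.1 ha, hT0 a.1 ha]; simp)
    (fun a x hx => by
      rw [deriv_cellFun, abs_div, abs_of_pos (K.len_pos _)]
      exact div_le_div₀ (by positivity) (abs_cellValue_sub_le N a.1 _ _) hℓ0 (he₀ a.2))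
  have hone : ∀ i ∈ Finset.Icc (1 : ℤ) N, ∀ x, w (i, e₀) x = 1 := fun i hi x => by
    simp [hw, cellFun, hT1 i hi]
  have hlow := fun q : ℝ => le_lpPow_periodic (K := K) (P := P) (q := q) e₀ hone
  have hwH : w ∈ (K.periodic P).H1 := cellFun_mem_H1
    (hmass.trans_lt ENNReal.ofReal_lt_top) (hkin.trans_lt ENNReal.ofReal_lt_top)
  have hcard : ((Finset.Icc (1 : ℤ) N).card : ℝ) = N := by simp
  simp only [hcard] at hlow
  have hm1 : ((K.periodic P).lpPow 2 w).toReal ≤ 6 * N * L := by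
    refine (ENNReal.toReal_le_of_le_ofReal (by positivity) hmass).trans ?_
    rw [Real.one_rpow, one_mul]
    gcongr
  have hm0 : 0 < ((K.periodic P).lpPow 2 w).toReal := by
    have := ENNReal.toReal_mono hwH.2.2.1.ne (hlow 2)
    rw [ENNReal.toReal_ofReal (by positivity)] at this
    exact lt_of_lt_of_le (by positivity) this
  have hk : ((K.periodic P).lpPow 2 fun a => deriv (w a)).toReal ≤ 6 * L / ℓ ^ 2 / N := by
    refine (ENNReal.toReal_le_of_le_ofReal (by positivity) hkin).trans ?_
    rw [Real.rpow_two]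
    calc (T.card : ℝ) * ((1 / N / ℓ) ^ 2 * L) ≤ 6 * N * ((1 / N / ℓ) ^ 2 * L) := by gcongr
      _ = _ := by field_simp
  have hpot : N * ℓ ≤ ((K.periodic P).lpPow p w).toReal := by
    have hlt : (K.periodic P).lpPow p w < ∞ :=
      H1.lpPow_lt_top (G := K.periodic P) hℓ0 (fun a => he₀ a.2) hp2.le hwH
    have := ENNReal.toReal_mono hlt.ne (hlow p)
    rwa [ENNReal.toReal_ofReal (by positivity)] at this
  obtain ⟨v, hv, hve⟩ := H1.exists_rescale (p := p) (by linarith) hμ hwH hm0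
  refine ⟨v, hv, ?_⟩
  rw [hve]
  set m := ((K.periodic P).lpPow 2 w).toReal with hm
  set r := μ / m with hr
  have hr0 : 0 < r := by positivity
  have hrb : b / N ≤ r := by
    rw [hb, hr, div_div]
    refine div_le_div_of_nonneg_left hμ.le hm0 (by linarith)
  have hrp : r ^ (p / 2) = r ^ s * r := by
    rw [← Real.rpow_add_one hr0.ne']; congr 1; rw [hs]; ring
  have hrs : (b / N) ^ s ≤ r ^ s := Real.rpow_le_rpow (by positivity) hrb (by linarith)
  have hkey : 6 * L / ℓ ^ 2 / N / 2 < (b / N) ^ s * (N * ℓ) / p := by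
    rw [hc, div_lt_iff₀ (by positivity)] at hNc
    rw [lt_div_iff₀ (by linarith), Real.div_rpow hb0.le hN0.le]
    have hN2 : (N : ℝ) ^ (2 - s) = N ^ 2 / N ^ s := by
      rw [Real.rpow_sub hN0, Real.rpow_two]
    rw [hN2] at hNc
    have h1 : 6 * L / ℓ ^ 2 / N / 2 * p = 3 * L / ℓ ^ 2 * p / N := by ring
    have h2 : b ^ s / N ^ s * (N * ℓ) = (N : ℝ) ^ 2 / N ^ s * (b ^ s * ℓ) / N := by
      field_simp
    rw [h1, h2]
    gcongr
  have h1 : ((K.periodic P).lpPow 2 fun a => deriv (w a)).toReal / 2 <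
      r ^ s * (((K.periodic P).lpPow p w).toReal) / p := by
    calc _ ≤ 6 * L / ℓ ^ 2 / N / 2 := by gcongr
      _ < (b / N) ^ s * (N * ℓ) / p := hkey
      _ ≤ _ := by gcongr
  rw [hrp, sub_neg]
  calc _ = r * (((K.periodic P).lpPow 2 fun a => deriv (w a)).toReal / 2) := by ring
    _ < r * (r ^ s * ((K.periodic P).lpPow p w).toReal / p) := by gcongr
    _ = _ := by ring

/-- Without edges, connectedness would identify all vertices. Gluing changes the copy index by
exactly one, so `(0, v)` and `(2, v)` are distinct. -/
theorem nonempty_of_connected_periodic (hconn : (K.periodic P).Connected) : Nonempty E := by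
  by_contra hE
  rw [not_nonempty_iff] at hE
  obtain ⟨v, -⟩ := P.donors_nonempty
  have h := hconn (Quotient.mk P.setoid (0, v)) (Quotient.mk P.setoid (2, v))
  have h2 : ∀ a b, Relation.EqvGen (fun a b => ∃ e, (K.periodic P).src e = a ∧
      (K.periodic P).tgt e = b) a b → a = b := by
    intro a b h
    induction h with
    | rel _ _ h => exact isEmptyElim h.choose.2
    | refl => rfl
    | symm _ _ _ ih => exact ih.symm
    | trans _ _ _ _ _ ih ih' => exact ih.trans ih'
  rcases Quotient.exact (h2 _ _ h) with h | h | h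
  · simpa using congrArg Prod.fst h
  · simpa using h.1
  · simpa using h.1

end MetricGraph

/-! ### Existence of ground states. -/

theorem theorem1p1 {V E : Type*} [Finite V] [Finite E] (K : MetricGraph V E) (P : PastingRule V)
    (hconn : (K.periodic P).Connected) (p : ℝ) (hp : p ∈ Set.Ioo (2 : ℝ) 6)
    (μ : ℝ) (hμ : 0 < μ) :
    ⊥ < (K.periodic P).groundLevel p μ ∧
    (K.periodic P).groundLevel p μ < 0 ∧
    ∃ u ∈ (K.periodic P).H1Mass μ,
      (K.periodic P).energy p u = (K.periodic P).groundLevel p μ := by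
  obtain ⟨hp2, hp6⟩ := hp
  have hE := MetricGraph.nonempty_of_connected_periodic hconn
  set G := K.periodic P with hG
  obtain ⟨e₀, he₀⟩ := Finite.exists_min K.len
  have hℓ := K.len_pos e₀
  have hlen : ∀ a, K.len e₀ ≤ G.len a := fun a => he₀ a.2
  obtain ⟨C, hC⟩ := MetricGraph.H1.exists_le_realEnergy hℓ hlen hp2 hp6 hμ
  have hmass : ∀ u ∈ G.H1Mass μ, (G.lpPow 2 u).toReal = μ := fun u hu => by
    rw [hu.2, ENNReal.toReal_ofReal hμ.le]
  have hbdd : BddBelow (G.realEnergy p '' G.H1Mass μ) := by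
    refine ⟨-C, ?_⟩
    rintro _ ⟨u, hu, rfl⟩
    have := hC u hu.1 (hmass u hu).le
    have h0 : 0 ≤ (G.lpPow 2 fun e => deriv (u e)).toReal := ENNReal.toReal_nonneg
    linarith
  obtain ⟨v, hv, hv0⟩ := MetricGraph.exists_realEnergy_neg (K := K) (P := P) hp2 hp6 hμ
  set I := sInf (G.realEnergy p '' G.H1Mass μ) with hI
  have hle : ∀ u ∈ G.H1Mass μ, I ≤ G.realEnergy p u := fun u hu =>
    csInf_le hbdd (mem_image_of_mem _ hu)
  have hI0 : I < 0 := (hle v hv).trans_lt hv0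
  obtain ⟨E', -, hE', hmem⟩ := exists_seq_tendsto_sInf
    (⟨_, v, hv, rfl⟩ : (G.realEnergy p '' G.H1Mass μ).Nonempty) hbdd
  choose u hu hue using hmem
  -- Once the energy is below `I / 2 < 0`, coercivity bounds the kinetic part and the potential part
  -- is at least `-I / 2`.
  obtain ⟨N, hN⟩ := eventually_atTop.1
    (hE'.eventually (gt_mem_nhds (show I < I / 2 by linarith)))
  have hkin : ∀ n, (G.lpPow 2 fun e => deriv (u (n + N) e)).toReal ≤ 4 * |C| := fun n => by
    have h1 := hC _ (hu (n + N)).1 (hmass _ (hu _)).le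
    have h2 := hN (n + N) (by omega)
    rw [hue] at h1
    linarith [le_abs_self C]
  have hpot : ∀ n, p * (-I / 2) ≤ (G.lpPow p (u (n + N))).toReal := fun n => by
    have h2 := hN (n + N) (by omega)
    have h3 := hue (n + N)
    have h0 : 0 ≤ (G.lpPow 2 fun e => deriv (u (n + N) e)).toReal := ENNReal.toReal_nonneg
    rw [MetricGraph.realEnergy] at h3
    rw [mul_comm, ← le_div_iff₀ (by linarith)]
    linarith
  obtain ⟨δ, hδ, hconc⟩ := MetricGraph.H1.exists_edgeMass_gt (G := G) hℓ hlen hp2 (μ := μ)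
    (K := 4 * |C|) (c := p * (-I / 2)) (by positivity) (mul_pos (by linarith) (by linarith))
  choose a ha using fun n =>
    hconc _ (hu (n + N)).1 (hmass _ (hu _)).le (hkin n) (hpot n)
  have := Fintype.ofFinite E
  -- Each function is shifted by the index of the cell of its heavy edge, which thus lies in cell
  -- `0`; the finite set `S` is the set of edges of that cell.
  obtain ⟨U, hU, hUI⟩ := MetricGraph.H1Mass.exists_realEnergy_le hℓ hlen hp2 hp6 hμ hI0 hle
    (u := fun n => MetricGraph.translate (a n).1 (u (n + N)))
    (fun n => ⟨MetricGraph.translate_mem_H1 (hu _).1 _, by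
      rw [MetricGraph.lpPow_translate]; exact (hu _).2⟩)
    (by
      simp only [hG, MetricGraph.realEnergy_translate]
      simp only [← hG, hue]
      exact hE'.comp (tendsto_add_atTop_nat N))
    (S := ({0} : Finset ℤ) ×ˢ Finset.univ) hδ
    (fun n => ⟨(0, (a n).2), by simp, by
      have := ha n
      simpa [MetricGraph.edgeMass, MetricGraph.translate, hG, MetricGraph.periodic] using this⟩)
  have hen : ∀ w ∈ G.H1Mass μ, G.energy p w = (G.realEnergy p w : EReal) := fun w hw =>
    MetricGraph.H1.energy_eq (by linarith) hw.1
      (MetricGraph.H1.lpPow_lt_top hℓ hlen hp2.le hw.1)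
  have hlevel : G.groundLevel p μ = (G.realEnergy p U : EReal) := by
    refine le_antisymm ((iInf₂_le U hU).trans_eq (hen U hU)) (le_iInf₂ fun w hw => ?_)
    rw [hen w hw, EReal.coe_le_coe_iff]
    exact hUI.trans (hle w hw)
  rw [hlevel]
  exact ⟨EReal.bot_lt_coe _, by exact_mod_cast hUI.trans_lt hI0, U, hU, hen U hU⟩
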